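/- Let $N\ge 2$. A symmetric tensor $\lambda=(\lambda_{ijkl})_{1\le i,j,k,l\le N}$ with real entries is called a one-loop fixed point if (repeated indices being summed over $1,\dots,N$) $$-\lambda_{ijkl}+\lambda_{ijmn}\lambda_{klmn}+\lambda_{ikmn}\lambda_{jlmn}+\lambda_{ilmn}\lambda_{jkmn}=0\qquad\text{for all } i,j,k,l .$$ For $r\ge 2$, let $\lambda\vee$ be the linear map on real symmetric tensors of rank $r$ over $\mathbb{R}^N$ given by $(\lambda\vee v)_{i_1\cdots i_r}=\lambda_{mn(i_1i_2}\,v_{i_3\cdots i_r)mn}$, where $(\cdots)$ denotes symmetrization with unit weight (the average over all permutations of $i_1,\dots,i_r$). The one-loop anomalous dimensions of the derivative-free operators of rank $r$ are the eigenvalues, with multiplicity, of $v\mapsto\frac{r(r-1)}{2}\,\lambda\vee v$. There are exactly $d_{N,r}=\binom{N+r-1}{r}$ of them, $\gamma_1,\dots,\gamma_{d_{N,r}}$, all real; put $$\langle\gamma^n\rangle_r^\lambda=\frac{1}{d_{N,r}}\sum_{v=1}^{d_{N,r}}\gamma_v^{\,n},\qquad n=1,2 .$$ Write $\langle\gamma^n\rangle_r^{O(N)}$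 for the value of this average at the $O(N)$ fixed point $\lambda^{O(N)}_{ijkl}=\frac{3}{N+8}\,\delta_{(ij}\delta_{kl)}$. Theorem 1. Let $\lambda$ be any real one-loop fixed point with $N\ge 2$ fields. (a) For every integer $r\ge 2$, $\ \langle\gamma\rangle_r^\lambda\le\langle\gamma\rangle_r^{O(N)}$. (b) For $r=2$: $\ \langle\gamma^2\rangle_2^\lambda\le\langle\gamma^2\rangle_2^{O(N)}$ if $N\in\{2,3,4\}$, and $\ \langle\gamma^2\rangle_2^\lambda\le\dfrac{1}{4(N+1)}$ if $N\ge 5$. (c) For every integer $r\ge 3$ with $N\le 4\left(r-\tfrac98\right)^2$, $$\langle\gamma^2\rangle_r^\lambda\le\langle\gamma^2\rangle_r^{O(N)}<\frac{r(r-1)(r^2-r+1)}{(N+5)^2}.$$ -/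

import Mathlib

noncomputable section

namespace OneLoop

/-- Real tensors of rank `r` over `ℝ^N`, given by their components `A_{i₁ … i_r}`. -/
abbrev Tensor (N r : ℕ) : Type := (Fin r → Fin N) → ℝ

/-- The space of symmetric tensors of rank `r` over `ℝ^N`. -/
def SymTensor (N r : ℕ) : Submodule ℝ (Tensor N r) where
  carrier := {A | ∀ (σ : Equiv.Perm (Fin r)) (i : Fin r → Fin N), A (i ∘ σ) = A i}
  add_mem' := by
    intro A B hA hB σ i
    simp only [Pi.add_apply, hA σ i, hB σ i]
  zero_mem' := by
    intro σ i
    rfl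
  smul_mem' := by
    intro c A hA σ i
    simp only [Pi.smul_apply, hA σ i]

/-- Symmetrization with unit weight:
`X_{(i₁ … i_r)} = (1 / r!) ∑_σ X_{i_{σ(1)} … i_{σ(r)}}`. -/
def symmetrize {N r : ℕ} : Tensor N r →ₗ[ℝ] Tensor N r where
  toFun X := fun i => (1 / (r.factorial : ℝ)) * ∑ σ : Equiv.Perm (Fin r), X (i ∘ σ)
  map_add' := by
    intro X Y
    funext i
    simp only [Pi.add_apply, Finset.sum_add_distrib, mul_add]
  map_smul' := by
    intro c X
    funext i
    simp only [Pi.smul_apply, smul_eq_mul, RingHom.id_apply, ← Finset.mul_sum]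
    ring

theorem symmetrize_mem {N r : ℕ} (X : Tensor N r) : symmetrize X ∈ SymTensor N r := by
  intro τ i
  show (1 / (r.factorial : ℝ)) * ∑ σ : Equiv.Perm (Fin r), X ((i ∘ τ) ∘ σ) =
    (1 / (r.factorial : ℝ)) * ∑ σ : Equiv.Perm (Fin r), X (i ∘ σ)
  congr 1
  exact Fintype.sum_equiv (Equiv.mulLeft τ) _ _ (fun σ => rfl)

/-- The double contraction `A_{m n i₁ i₂} B_{i₃ … i_r m n}` of a tensor `A` of rank four and a
tensor `B` of rank `r ≥ 2` (set to zero for `r = 0, 1`). -/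
def contract {N : ℕ} (A : Tensor N 4) : {r : ℕ} → Tensor N r → Tensor N r
  | 0, _ => 0
  | 1, _ => 0
  | s + 2, B => fun i => ∑ m : Fin N, ∑ n : Fin N, A ![m, n, i 0, i 1] *
      B (Fin.snoc (Fin.snoc (fun k : Fin s => i k.succ.succ) m : Fin (s + 1) → Fin N) n)

theorem contract_add {N : ℕ} (A : Tensor N 4) {r : ℕ} (B C : Tensor N r) :
    contract A (B + C) = contract A B + contract A C := by
  match r with
  | 0 => simp [contract]
  | 1 => simp [contract]
  | s + 2 =>
    funext i
    simp only [contract, Pi.add_apply, mul_add, Finset.sum_add_distrib]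

theorem contract_smul {N : ℕ} (A : Tensor N 4) {r : ℕ} (c : ℝ) (B : Tensor N r) :
    contract A (c • B) = c • contract A B := by
  match r with
  | 0 => simp [contract]
  | 1 => simp [contract]
  | s + 2 =>
    funext i
    simp only [contract, Pi.smul_apply, smul_eq_mul, Finset.mul_sum]
    refine Finset.sum_congr rfl fun m _ => Finset.sum_congr rfl fun n _ => ?_
    ring

/-- The linear map `B ↦ A ∨ B` on symmetric tensors of rank `r`, where
`(A ∨ B)_{i₁ … i_r} = A_{m n (i₁ i₂} B_{i₃ … i_r) m n}`. -/
def vee {N : ℕ} (A : SymTensor N 4) (r : ℕ) : SymTensor N r →ₗ[ℝ] SymTensor N r where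
  toFun B := ⟨symmetrize (contract A.1 B.1), symmetrize_mem _⟩
  map_add' := by
    intro B C
    apply Subtype.ext
    simp [contract_add]
  map_smul' := by
    intro c B
    apply Subtype.ext
    simp [contract_smul]

/-- The one-loop beta function, in the normalization `B = 16 π²`. -/
def beta {N : ℕ} (lam : SymTensor N 4) (i j k l : Fin N) : ℝ :=
  -lam.1 ![i, j, k, l] + ∑ m : Fin N, ∑ n : Fin N,
    (lam.1 ![i, j, m, n] * lam.1 ![k, l, m, n] + lam.1 ![i, k, m, n] * lam.1 ![j, l, m, n] +
      lam.1 ![i, l, m, n] * lam.1 ![j, k, m, n])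

/-- A real one-loop fixed point with `N` scalar fields. -/
def IsFixedPoint {N : ℕ} (lam : SymTensor N 4) : Prop :=
  ∀ i j k l : Fin N, beta lam i j k l = 0

/-- The matrix of the one-loop anomalous dimensions of the derivative-free operators with `r`
fields: `v ↦ (r (r - 1) / 2) λ ∨ v` on symmetric tensors of rank `r`. -/
def anomalousOp {N : ℕ} (lam : SymTensor N 4) (r : ℕ) : SymTensor N r →ₗ[ℝ] SymTensor N r :=
  ((r : ℝ) * ((r : ℝ) - 1) / 2) • vee lam r

/-- The one-loop anomalous dimensions of the derivative-free operators with `r` fields: the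
eigenvalues, with multiplicity, of `anomalousOp` (which is self-adjoint for the inner product
`A_{i₁ … i_r} B_{i₁ … i_r}`, so that all its eigenvalues are real). -/
def anomalousDims {N : ℕ} (lam : SymTensor N 4) (r : ℕ) : Multiset ℝ :=
  (anomalousOp lam r).charpoly.roots

/-- The number `d_{N,r}` of derivative-free operators with `r` out of `N` fields. -/
def numOps (N r : ℕ) : ℕ := (N + r - 1).choose r

/-- The average `⟨γ^n⟩_r` of the `n`-th power of the one-loop anomalous dimensions of the
derivative-free operators with `r` fields. -/
def avgGamma {N : ℕ} (lam : SymTensor N 4) (n r : ℕ) : ℝ :=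
  (1 / (numOps N r : ℝ)) * ((anomalousDims lam r).map (fun γ => γ ^ n)).sum

/-- The Kronecker delta. -/
def delta {N : ℕ} (i j : Fin N) : ℝ := if i = j then 1 else 0

/-- The `O(N)` fixed point `(3 / (N + 8)) δ_{(i j} δ_{k l)}`. -/
def couplingON (N : ℕ) : SymTensor N 4 :=
  ⟨symmetrize (fun i => 3 / ((N : ℝ) + 8) * (delta (i 0) (i 1) * delta (i 2) (i 3))),
    symmetrize_mem _⟩

end OneLoop

end

/-! Identify a symmetric tensor of rank r with the form of degree r that it defines. The
anomalous-dimension matrix becomes the operator D = ½ λ_{ijmn} x_i x_j ∂_m ∂_n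
(`toPoly_anomalousOp`). It is self-adjoint, so the power sums of its eigenvalues are the traces of D
and D² on forms of degree r. Cyclicity of the trace and normal ordering express these traces through
a = λ_{iijj}, q = λ_{ijkk} λ_{ijll} and S = λ_{ijkl} λ_{ijkl}: the first moment is a positive
multiple of a (`avgGamma_one`), the second a combination of a², q and S with nonnegative weights
(`avgGamma_two`).

The fixed-point equation enters only through its full contraction a = q + 2S
(`IsFixedPoint.fullTrace_eq`). Two inequalities hold for every λ: a² ≤ Nq by Cauchy–Schwarz
(`fullTrace_sq_le`), and a lower bound on S because the traceless part of λ has nonnegative norm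
(`normSq_ge`). Both are equalities at the O(N) point. Together they give a ≤ b := N(N+2)/(N+8), the
O(N) value, which is the bound on the first moment.

For r = 2 the second moment is a multiple of S alone, and S ≤ (a − a²/N)/2. This parabola peaks at a
= N/2 with value N/8; for N ≤ 4 the range a ≤ b stops before the peak, so O(N) is extremal.

For r ≥ 3, measure q and S by their slacks t, d ≥ 0 in the two inequalities. The second moment is A
a² plus nonnegative multiples of t and d, while the traced equation fixes one positive combination
of t and d as a − a²/b. If the multiples are small enough, the total is at most A(2ab − a²) ≤ A b²,
the O(N) value (`secondMoment_le`). The hypothesis N ≤ 4(r − 9/8)² guarantees this smallness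
(`dominance_condition`). -/

namespace OneLoop

open MvPolynomial

/-! ### Symmetric tensors as homogeneous polynomials -/

/-- The homogeneous polynomial `A_{i₁ … i_r} x_{i₁} ⋯ x_{i_r}` of a tensor `A` of rank `r`. -/
noncomputable def toPoly (N r : ℕ) : Tensor N r →ₗ[ℝ] MvPolynomial (Fin N) ℝ :=
  ∑ i : Fin r → Fin N, (LinearMap.proj i).smulRight (∏ k, X (i k))

theorem toPoly_apply {N r : ℕ} (A : Tensor N r) :
    toPoly N r A = ∑ i : Fin r → Fin N, A i • ∏ k, (X (i k) : MvPolynomial (Fin N) ℝ) := by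
  simp [toPoly]

theorem toPoly_isHomogeneous {N r : ℕ} (A : Tensor N r) : (toPoly N r A).IsHomogeneous r := by
  rw [toPoly_apply]
  refine IsHomogeneous.sum _ _ _ fun i _ => ?_
  rw [smul_eq_C_mul]
  have h := (isHomogeneous_C (Fin N) (A i)).mul
    (IsHomogeneous.prod Finset.univ (fun k => (X (i k) : MvPolynomial (Fin N) ℝ)) (fun _ => 1)
      fun k _ => isHomogeneous_X ℝ (i k))
  simpa using h

theorem toPoly_symmetrize {N r : ℕ} (A : Tensor N r) :
    toPoly N r (symmetrize A) = toPoly N r A := by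
  have key : ∀ σ : Equiv.Perm (Fin r), toPoly N r (fun i => A (i ∘ σ)) = toPoly N r A := by
    intro σ
    rw [toPoly_apply, toPoly_apply]
    refine Fintype.sum_equiv (σ.symm.arrowCongr (Equiv.refl _)) _ _ fun i => ?_
    have h : (σ.symm.arrowCongr (Equiv.refl (Fin N))) i = i ∘ σ := rfl
    rw [h]
    congr 1
    exact (Equiv.prod_comp σ fun k => (X (i k) : MvPolynomial (Fin N) ℝ)).symm
  have h : symmetrize A =
      (1 / (r.factorial : ℝ)) • ∑ σ : Equiv.Perm (Fin r), fun i => A (i ∘ σ) := by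
    funext i
    simp [symmetrize]
  rw [h, map_smul, map_sum, Finset.sum_congr rfl fun σ _ => key σ, Finset.sum_const,
    Finset.card_univ, Fintype.card_perm, Fintype.card_fin, ← Nat.cast_smul_eq_nsmul ℝ, smul_smul]
  have : (r.factorial : ℝ) ≠ 0 := by positivity
  rw [one_div_mul_cancel this, one_smul]

theorem sum_tensor_succ {M : Type*} [AddCommMonoid M] {N s : ℕ} (f : (Fin (s + 1) → Fin N) → M) :
    ∑ i, f i = ∑ a : Fin N, ∑ j : Fin s → Fin N, f (Fin.cons a j) := by
  rw [← Fintype.sum_prod_type']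
  exact (Fintype.sum_equiv (Fin.consEquiv fun _ => Fin N) _ _ fun x => rfl).symm

theorem toPoly_succ {N s : ℕ} (A : Tensor N (s + 1)) :
    toPoly N (s + 1) A = ∑ a : Fin N, X a * toPoly N s fun j => A (Fin.cons a j) := by
  rw [toPoly_apply, sum_tensor_succ]
  refine Finset.sum_congr rfl fun a _ => ?_
  rw [toPoly_apply, Finset.mul_sum]
  refine Finset.sum_congr rfl fun j _ => ?_
  rw [Fin.prod_univ_succ]
  simp

theorem slice_mem {N s : ℕ} {A : Tensor N (s + 1)} (hA : A ∈ SymTensor N (s + 1)) (a : Fin N) :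
    (fun j => A (Fin.cons a j)) ∈ SymTensor N s := by
  intro σ j
  -- The permutation that fixes 0 and acts as σ on the remaining indices.
  have h := hA (Equiv.Perm.decomposeFin.symm (0, σ)) (Fin.cons a j)
  refine Eq.trans (congrArg A ?_) h
  funext k
  refine Fin.cases ?_ (fun k => ?_) k <;> simp

theorem apply_cons_swap {N s : ℕ} {A : Tensor N (s + 2)} (hA : A ∈ SymTensor N (s + 2))
    (a b : Fin N) (j : Fin s → Fin N) :
    A (Fin.cons a (Fin.cons b j)) = A (Fin.cons b (Fin.cons a j)) := by
  rw [← hA (Equiv.swap 0 1) (Fin.cons a (Fin.cons b j))]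
  congr 1
  funext k
  refine Fin.cases ?_ (fun k => Fin.cases ?_ (fun k => ?_) k) k
  · simp
  · have : (Fin.succ 0 : Fin (s + 2)) = 1 := rfl
    simp [this]
  · have h0 : k.succ.succ ≠ (0 : Fin (s + 2)) := Fin.succ_ne_zero _
    have h1 : k.succ.succ ≠ (1 : Fin (s + 2)) := by
      intro h
      exact Fin.succ_ne_zero k (Fin.succ_injective _ h)
    simp [Equiv.swap_apply_of_ne_of_ne h0 h1]

theorem apply_snoc {N s : ℕ} {A : Tensor N (s + 1)} (hA : A ∈ SymTensor N (s + 1))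
    (a : Fin N) (j : Fin s → Fin N) :
    A (Fin.snoc j a : Fin (s + 1) → Fin N) = A (Fin.cons a j) := by
  have h : (Fin.snoc j a : Fin (s + 1) → Fin N) =
    (Fin.cons a j : Fin (s + 1) → Fin N) ∘ finRotate (s + 1) := Fin.snoc_eq_cons_rotate j a
  rw [h, hA]

theorem pderiv_toPoly {N s : ℕ} {A : Tensor N (s + 1)} (hA : A ∈ SymTensor N (s + 1))
    (m : Fin N) :
    pderiv m (toPoly N (s + 1) A) = ((s : ℝ) + 1) • toPoly N s fun j => A (Fin.cons m j) := by
  induction s with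
  | zero =>
    rw [toPoly_succ, map_sum]
    simp only [Derivation.leibniz, pderiv_X, Pi.single_apply]
    have h : ∀ B : Tensor N 0, pderiv m (toPoly N 0 B) = 0 := by
      intro B
      simp [toPoly_apply]
    simp [h]
  | succ s ih =>
    rw [toPoly_succ, map_sum]
    simp only [Derivation.leibniz, pderiv_X, Pi.single_apply, Finset.sum_add_distrib]
    have h1 : ∀ a : Fin N, pderiv m (toPoly N (s + 1) fun j => A (Fin.cons a j)) =
        ((s : ℝ) + 1) • toPoly N s fun j => A (Fin.cons m (Fin.cons a j)) := by
      intro a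
      rw [ih (slice_mem hA a)]
      congr 2
      funext j
      exact apply_cons_swap hA a m j
    simp only [h1]
    rw [toPoly_succ (fun j => A (Fin.cons m j))]
    simp only [smul_eq_mul, mul_smul_comm, ← Finset.smul_sum]
    rw [← toPoly_succ (fun j => A (Fin.cons m j))]
    simp only [mul_ite, mul_one, mul_zero, Finset.sum_ite_eq',
      Finset.mem_univ, if_true]
    push_cast
    module

/-- Partial derivatives of the polynomial are nonzero multiples of the polynomials of the slices of
A, so induction on the rank kills every slice. -/
theorem toPoly_injective {N r : ℕ} {A : Tensor N r} (hA : A ∈ SymTensor N r)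
    (h : toPoly N r A = 0) : A = 0 := by
  induction r with
  | zero =>
    funext i
    rw [toPoly_apply] at h
    simp only [Finset.univ_unique, Finset.univ_eq_empty, Finset.prod_empty,
      Finset.sum_singleton] at h
    rw [smul_eq_zero] at h
    rw [Subsingleton.elim i default]
    simpa using h
  | succ s ih =>
    funext i
    have h1 := pderiv_toPoly hA (i 0)
    rw [h, map_zero] at h1
    have h2 : (s : ℝ) + 1 ≠ 0 := by positivity
    have h3 := ih (slice_mem hA (i 0)) ((smul_eq_zero.mp h1.symm).resolve_left h2)
    have h4 := congrFun h3 (Fin.tail i)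
    simpa using h4

theorem exists_monomial_eq_prod {N r : ℕ} (d : Fin N →₀ ℕ) (hd : d.degree = r) :
    ∃ i : Fin r → Fin N, monomial d (1 : ℝ) = ∏ k, X (i k) := by
  induction r generalizing d with
  | zero =>
    refine ⟨Fin.elim0, ?_⟩
    have : d = 0 := by simpa [Finsupp.degree_eq_zero_iff] using hd
    simp [this]
  | succ s ih =>
    have hne : d ≠ 0 := by
      rintro rfl
      simp at hd
    obtain ⟨a, ha⟩ := Finsupp.ne_iff.mp hne
    have hle : Finsupp.single a 1 ≤ d := by
      rw [Finsupp.single_le_iff]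
      exact Nat.one_le_iff_ne_zero.mpr ha
    have hsum : Finsupp.single a 1 + (d - Finsupp.single a 1) = d := add_tsub_cancel_of_le hle
    obtain ⟨i, hi⟩ := ih (d - Finsupp.single a 1) (by
      have h := congrArg Finsupp.degree hsum
      rw [map_add, hd, Finsupp.degree_single] at h
      omega)
    refine ⟨Fin.cons a i, ?_⟩
    rw [Fin.prod_univ_succ]
    simp only [Fin.cons_zero, Fin.cons_succ, ← hi]
    rw [X, monomial_mul, mul_one, hsum]

/-- A monomial of degree r is a product of r coordinates, hence the image of a basis tensor;
symmetrizing that tensor does not change the image. -/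
theorem exists_toPoly_eq {N r : ℕ} {p : MvPolynomial (Fin N) ℝ} (hp : p.IsHomogeneous r) :
    ∃ A ∈ SymTensor N r, toPoly N r A = p := by
  suffices h : p ∈ LinearMap.range ((toPoly N r).comp (SymTensor N r).subtype) by
    obtain ⟨A, hA⟩ := h
    exact ⟨A.1, A.2, hA⟩
  rw [p.as_sum]
  refine Submodule.sum_mem _ fun d hd => ?_
  obtain ⟨i, hi⟩ := exists_monomial_eq_prod d (r := r) (by
    by_contra hne
    exact (mem_support_iff.mp hd) (hp.coeff_eq_zero hne))
  refine ⟨⟨symmetrize (Pi.single i (coeff d p)), symmetrize_mem _⟩, ?_⟩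
  show toPoly N r (symmetrize _) = _
  rw [toPoly_symmetrize, toPoly_apply, Finset.sum_eq_single i, Pi.single_eq_same, ← hi,
    smul_monomial, smul_eq_mul, mul_one]
  · intro j _ hj
    rw [Pi.single_eq_of_ne hj, zero_smul]
  · simp

/-- Symmetric tensors of rank `r` are homogeneous polynomials of degree `r`. -/
noncomputable def toPolyEquiv (N r : ℕ) :
    SymTensor N r ≃ₗ[ℝ] homogeneousSubmodule (Fin N) ℝ r :=
  LinearEquiv.ofBijective
    (((toPoly N r).comp (SymTensor N r).subtype).codRestrict _ fun A => toPoly_isHomogeneous A.1)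
    ⟨by
      rw [injective_iff_map_eq_zero]
      intro A hA
      exact Subtype.ext (toPoly_injective A.2 (congrArg Subtype.val hA)),
    by
      rintro ⟨p, hp⟩
      obtain ⟨A, hA, h⟩ := exists_toPoly_eq hp
      exact ⟨⟨A, hA⟩, Subtype.ext h⟩⟩

theorem toPolyEquiv_coe {N r : ℕ} (A : SymTensor N r) :
    (toPolyEquiv N r A : MvPolynomial (Fin N) ℝ) = toPoly N r A.1 := rfl

instance finite_homogeneousSubmodule (N r : ℕ) :
    Module.Finite ℝ (homogeneousSubmodule (Fin N) ℝ r) :=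
  Module.Finite.equiv (toPolyEquiv N r)

/-! ### The anomalous dimensions as a differential operator -/

/-- Multiplication by the coordinate `x_i`. -/
noncomputable def mulX {N : ℕ} (i : Fin N) : Module.End ℝ (MvPolynomial (Fin N) ℝ) :=
  LinearMap.mulLeft ℝ (X i)

/-- The partial derivative with respect to `x_i`. -/
noncomputable def partialD {N : ℕ} (i : Fin N) : Module.End ℝ (MvPolynomial (Fin N) ℝ) :=
  (pderiv i).toLinearMap

/-- The one-loop dilatation operator `½ A_{ijmn} x_i x_j ∂_m ∂_n`. -/
noncomputable def dilatation {N : ℕ} (A : Fin N → Fin N → Fin N → Fin N → ℝ) :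
    Module.End ℝ (MvPolynomial (Fin N) ℝ) :=
  (1 / 2 : ℝ) • ∑ i, ∑ j, ∑ m, ∑ n, A i j m n • (mulX i * (mulX j * (partialD m * partialD n)))

/-- The components of a tensor of rank four. -/
def comp4 {N : ℕ} (lam : SymTensor N 4) (i j k l : Fin N) : ℝ := lam.1 ![i, j, k, l]

theorem comp4_swap12 {N : ℕ} (lam : SymTensor N 4) (i j k l : Fin N) :
    comp4 lam i j k l = comp4 lam j i k l := by
  unfold comp4
  rw [← lam.2 (Equiv.swap 0 1) ![j, i, k, l]]
  refine congrArg lam.1 ?_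
  funext x
  fin_cases x <;> rfl

theorem comp4_swap23 {N : ℕ} (lam : SymTensor N 4) (i j k l : Fin N) :
    comp4 lam i j k l = comp4 lam i k j l := by
  unfold comp4
  rw [← lam.2 (Equiv.swap 1 2) ![i, k, j, l]]
  refine congrArg lam.1 ?_
  funext x
  fin_cases x <;> rfl

theorem comp4_swap34 {N : ℕ} (lam : SymTensor N 4) (i j k l : Fin N) :
    comp4 lam i j k l = comp4 lam i j l k := by
  unfold comp4
  rw [← lam.2 (Equiv.swap 2 3) ![i, j, l, k]]
  refine congrArg lam.1 ?_
  funext x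
  fin_cases x <;> rfl

theorem comp4_swap_pairs {N : ℕ} (lam : SymTensor N 4) (i j k l : Fin N) :
    comp4 lam i j k l = comp4 lam k l i j := by
  rw [comp4_swap23, comp4_swap12, comp4_swap34, comp4_swap23]

theorem toPoly_contract {N s : ℕ} (lam : SymTensor N 4) (B : SymTensor N (s + 2)) :
    toPoly N (s + 2) (contract lam.1 B.1) = ∑ i, ∑ j, ∑ m, ∑ n, comp4 lam i j m n •
      (X i * (X j * toPoly N s fun t => B.1 (Fin.cons n (Fin.cons m t)))) := by
  rw [toPoly_succ]
  simp only [toPoly_succ (s := s), Finset.mul_sum]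
  refine Finset.sum_congr rfl fun i _ => Finset.sum_congr rfl fun j _ => ?_
  have h : (fun t : Fin s → Fin N => contract lam.1 B.1 (Fin.cons i (Fin.cons j t))) =
      ∑ m, ∑ n, comp4 lam i j m n • fun t => B.1 (Fin.cons n (Fin.cons m t)) := by
    funext t
    simp only [contract, Finset.sum_apply, Pi.smul_apply, smul_eq_mul]
    refine Finset.sum_congr rfl fun m _ => Finset.sum_congr rfl fun n _ => ?_
    rw [comp4_swap_pairs, apply_snoc B.2, apply_snoc (slice_mem B.2 n)]
    rfl
  rw [h]
  simp only [map_sum, map_smul, Finset.mul_sum, mul_smul_comm]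

theorem toPoly_anomalousOp {N s : ℕ} (lam : SymTensor N 4) (B : SymTensor N (s + 2)) :
    toPoly N (s + 2) (anomalousOp lam (s + 2) B).1 =
      dilatation (comp4 lam) (toPoly N (s + 2) B.1) := by
  have h1 : (anomalousOp lam (s + 2) B).1 = ((((s + 2 : ℕ) : ℝ)) * (((s + 2 : ℕ) : ℝ) - 1) / 2) •
      symmetrize (contract lam.1 B.1) := rfl
  rw [h1, map_smul, toPoly_symmetrize, toPoly_contract]
  have h2 : ∀ m n : Fin N, pderiv m (pderiv n (toPoly N (s + 2) B.1)) =
      (((s : ℝ) + 2) * ((s : ℝ) + 1)) • toPoly N s fun t => B.1 (Fin.cons n (Fin.cons m t)) := by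
    intro m n
    rw [pderiv_toPoly B.2, Derivation.map_smul, pderiv_toPoly (slice_mem B.2 n), smul_smul]
    push_cast
    congr 1
    ring
  simp only [dilatation, LinearMap.smul_apply, LinearMap.sum_apply, Module.End.mul_apply, mulX,
    partialD, Derivation.coeFn_coe, LinearMap.mulLeft_apply, h2, mul_smul_comm, Finset.smul_sum,
    smul_smul]
  refine Finset.sum_congr rfl fun i _ => Finset.sum_congr rfl fun j _ =>
    Finset.sum_congr rfl fun m _ => Finset.sum_congr rfl fun n _ => ?_
  push_cast
  congr 1
  ring

variable {N : ℕ}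

theorem mulX_comm (i j : Fin N) : (mulX i * mulX j : Module.End ℝ _) = mulX j * mulX i := by
  refine LinearMap.ext fun p => ?_
  exact mul_left_comm (X i) (X j) p

theorem partialD_mul_mulX (m i : Fin N) :
    (partialD m * mulX i : Module.End ℝ _) = mulX i * partialD m + delta i m • 1 := by
  refine LinearMap.ext fun p => ?_
  simp only [mulX, partialD, Module.End.mul_apply, LinearMap.mulLeft_apply, LinearMap.add_apply,
    LinearMap.smul_apply, Module.End.one_apply, Derivation.coeFn_coe, Derivation.leibniz,
    pderiv_X, delta, Pi.single_apply, smul_eq_mul]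
  split_ifs <;> simp

theorem partialD_mul_mulX_mul (m i : Fin N) (f : Module.End ℝ (MvPolynomial (Fin N) ℝ)) :
    partialD m * (mulX i * f) = mulX i * (partialD m * f) + delta i m • f := by
  rw [← mul_assoc, partialD_mul_mulX, add_mul, mul_assoc, smul_mul_assoc, one_mul]

/-! ### Traces on homogeneous polynomials -/

/-- The inclusion-projection trace of an endomorphism of the polynomial ring on the homogeneous
polynomials of degree `r`. -/
noncomputable def degTrace (N r : ℕ) : Module.End ℝ (MvPolynomial (Fin N) ℝ) →ₗ[ℝ] ℝ where
  toFun f := LinearMap.trace ℝ (homogeneousSubmodule (Fin N) ℝ r)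
    (((homogeneousComponent r).codRestrict (homogeneousSubmodule (Fin N) ℝ r)
      fun p => homogeneousComponent_isHomogeneous r p) ∘ₗ f ∘ₗ Submodule.subtype _)
  map_add' f g := by
    rw [LinearMap.add_comp, LinearMap.comp_add, map_add]
  map_smul' c f := by
    rw [LinearMap.smul_comp, LinearMap.comp_smul, map_smul, RingHom.id_apply]

theorem degTrace_eq_trace {r : ℕ} (f : Module.End ℝ (MvPolynomial (Fin N) ℝ))
    (g : Module.End ℝ (homogeneousSubmodule (Fin N) ℝ r)) (h : ∀ p, (g p).1 = f p.1) :
    degTrace N r f = LinearMap.trace ℝ _ g := by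
  show LinearMap.trace ℝ _ _ = _
  congr 1
  refine LinearMap.ext fun p => Subtype.ext ?_
  show homogeneousComponent r (f p.1) = (g p).1
  rw [← h p, homogeneousComponent_of_mem (g p).2, if_pos rfl]

theorem homogeneousComponent_succ_X_mul (r : ℕ) (i : Fin N) (p : MvPolynomial (Fin N) ℝ) :
    homogeneousComponent (r + 1) (X i * p) = X i * homogeneousComponent r p := by
  ext d
  rw [coeff_homogeneousComponent, coeff_X_mul', coeff_X_mul', coeff_homogeneousComponent]
  by_cases hi : i ∈ d.support
  · rw [if_pos hi, if_pos hi]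
    have hle : Finsupp.single i 1 ≤ d := by
      rw [Finsupp.single_le_iff]
      exact Nat.one_le_iff_ne_zero.mpr (Finsupp.mem_support_iff.mp hi)
    have h := congrArg Finsupp.degree (add_tsub_cancel_of_le hle)
    rw [map_add, Finsupp.degree_single] at h
    have h2 : d.degree = r + 1 ↔ (d - Finsupp.single i 1).degree = r := by omega
    simp only [h2]
  · rw [if_neg hi, if_neg hi, ite_self]

theorem homogeneousComponent_zero_X_mul (i : Fin N) (p : MvPolynomial (Fin N) ℝ) :
    homogeneousComponent 0 (X i * p) = 0 := by
  rw [homogeneousComponent_zero, coeff_X_mul']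
  simp

theorem degTrace_zero_mulX_mul (i : Fin N) (f : Module.End ℝ (MvPolynomial (Fin N) ℝ)) :
    degTrace N 0 (mulX i * f) = 0 := by
  refine (congrArg (LinearMap.trace ℝ _) ?_).trans (map_zero _)
  refine LinearMap.ext fun p => Subtype.ext ?_
  exact homogeneousComponent_zero_X_mul i _

/-- Tr(AB) = Tr(BA) for multiplication by x_i from degree r to r + 1 and the degree-r part of f in
the other direction. With the vanishing in degree 0, this makes every trace below computable by
induction on the degree. -/
theorem degTrace_succ_mulX_mul (r : ℕ) (i : Fin N)
    (f : Module.End ℝ (MvPolynomial (Fin N) ℝ)) :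
    degTrace N (r + 1) (mulX i * f) = degTrace N r (f * mulX i) := by
  let ι := Submodule.subtype (homogeneousSubmodule (Fin N) ℝ (r + 1))
  let proj := (homogeneousComponent r).codRestrict (homogeneousSubmodule (Fin N) ℝ r)
      fun p => homogeneousComponent_isHomogeneous r p
  let M : homogeneousSubmodule (Fin N) ℝ r →ₗ[ℝ] homogeneousSubmodule (Fin N) ℝ (r + 1) :=
    ((mulX i) ∘ₗ Submodule.subtype _).codRestrict _ fun p => by
      have h := (isHomogeneous_X ℝ i).mul p.2
      rw [add_comm] at h
      exact h
  have h := LinearMap.trace_comp_comm' (proj ∘ₗ f ∘ₗ ι) M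
  refine Eq.trans (congrArg (LinearMap.trace ℝ _) ?_)
    (h.trans (congrArg (LinearMap.trace ℝ _) ?_))
  · refine LinearMap.ext fun p => Subtype.ext ?_
    exact homogeneousComponent_succ_X_mul r i _
  · rfl

theorem degTrace_zero_one : degTrace N 0 1 = 1 := by
  rw [degTrace_eq_trace 1 1 fun p => rfl, LinearMap.trace_one]
  have h : SymTensor N 0 = ⊤ := by
    refine eq_top_iff.mpr fun A _ σ i => ?_
    rw [Subsingleton.elim (i ∘ σ) i]
  rw [← (toPolyEquiv N 0).finrank_eq, h, finrank_top, Module.finrank_fintype_fun_eq_card]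
  simp

/-- Euler's operator ∑ x_i ∂_i acts as the degree. Cycling x_i round in its trace gives a recursion
for the dimension, so no monomials need be counted. -/
theorem degTrace_one_succ (r : ℕ) :
    ((r : ℝ) + 1) * degTrace N (r + 1) 1 = ((r : ℝ) + N) * degTrace N r 1 := by
  have euler : ∀ s : ℕ, degTrace N s (∑ i, mulX i * partialD i) = s * degTrace N s 1 := by
    intro s
    rw [degTrace_eq_trace _ ((s : ℝ) • 1), map_smul, smul_eq_mul, degTrace_eq_trace 1 1]
    · exact fun p => rfl
    · intro p
      have h := IsHomogeneous.sum_X_mul_pderiv p.2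
      simp only [LinearMap.sum_apply, Module.End.mul_apply, mulX, partialD,
        LinearMap.mulLeft_apply, Derivation.coeFn_coe, h]
      simp [← Nat.cast_smul_eq_nsmul ℝ]
  have h1 := euler (r + 1)
  have h2 := euler r
  rw [map_sum] at h1 h2
  simp only [degTrace_succ_mulX_mul, partialD_mul_mulX, map_add, Finset.sum_add_distrib, h2,
    delta, if_true, one_smul, Finset.sum_const, Finset.card_univ, Fintype.card_fin,
    nsmul_eq_mul] at h1
  push_cast at h1
  linarith

/-! ### Traces of normal-ordered operators -/

/-- The number of ways to choose `M + k` out of `M + r`. -/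
noncomputable def bodyCoeff (M r k : ℕ) : ℝ := ((M + r).choose (M + k) : ℝ)

theorem bodyCoeff_zero_succ (M k : ℕ) : bodyCoeff M 0 (k + 1) = 0 := by
  unfold bodyCoeff
  rw [Nat.choose_eq_zero_of_lt (by omega), Nat.cast_zero]

theorem bodyCoeff_succ_succ (M r k : ℕ) :
    bodyCoeff M (r + 1) (k + 1) = bodyCoeff M r (k + 1) + bodyCoeff M r k := by
  unfold bodyCoeff
  rw [← add_assoc, ← add_assoc, Nat.choose_succ_succ]
  push_cast
  ring

theorem degTrace_one (M r : ℕ) : degTrace (M + 1) r 1 = bodyCoeff M r 0 := by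
  induction r with
  | zero => simp [degTrace_zero_one, bodyCoeff]
  | succ r ih =>
    have h := degTrace_one_succ (N := M + 1) r
    rw [ih] at h
    have h2 : ((r : ℝ) + 1) * bodyCoeff M (r + 1) 0 = ((r : ℝ) + (M + 1)) * bodyCoeff M r 0 := by
      unfold bodyCoeff
      have := Nat.add_one_mul_choose_eq (M + r) r
      have e1 : (M + (r + 1)).choose (M + 0) = (M + r + 1).choose (r + 1) :=
        Nat.choose_symm_of_eq_add (show M + r + 1 = (M + 0) + (r + 1) by omega)
      have e2 : (M + r).choose (M + 0) = (M + r).choose r :=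
        Nat.choose_symm_of_eq_add (show M + r = (M + 0) + r by omega)
      rw [e1, e2]
      have h3 : (((M + r).succ * (M + r).choose r : ℕ) : ℝ) =
        (((M + r).succ.choose r.succ * r.succ : ℕ) : ℝ) := by rw [this]
      push_cast at h3
      simp only [Nat.succ_eq_add_one] at h3
      linarith
    have h4 : (r : ℝ) + 1 ≠ 0 := by positivity
    apply mul_left_cancel₀ h4
    rw [h, h2]
    push_cast
    ring

/-- The permanent of the matrix of Kronecker deltas of two pairs of indices. -/
noncomputable def deltaPerm2 (i j m n : Fin N) : ℝ := delta i m * delta j n + delta i n * delta j m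

/-- The permanent of the matrix of Kronecker deltas of two triples of indices. -/
noncomputable def deltaPerm3 (i j k m n p : Fin N) : ℝ :=
  delta i m * deltaPerm2 j k n p + delta i n * deltaPerm2 j k m p + delta i p * deltaPerm2 j k m n

/-- The permanent of the matrix of Kronecker deltas of two quadruples of indices. -/
noncomputable def deltaPerm4 (i j k l m n p q : Fin N) : ℝ :=
  delta i m * deltaPerm3 j k l n p q + delta i n * deltaPerm3 j k l m p q +
    delta i p * deltaPerm3 j k l m n q + delta i q * deltaPerm3 j k l m n p

variable {M : ℕ}

/-- The pattern for all k-body traces: cycle the leading x_i to the back and commute it home through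
the derivatives. The same operator returns in degree r, plus (k − 1)-body terms weighted by deltas;
the coefficients add by Pascal's rule. -/
theorem degTrace_body1 (r : ℕ) (i m : Fin (M + 1)) :
    degTrace (M + 1) r (mulX i * partialD m) = bodyCoeff M r 1 * delta i m := by
  induction r with
  | zero => rw [degTrace_zero_mulX_mul, bodyCoeff_zero_succ, zero_mul]
  | succ r ih =>
    rw [degTrace_succ_mulX_mul, partialD_mul_mulX, map_add, map_smul, ih, degTrace_one,
      bodyCoeff_succ_succ, smul_eq_mul]
    ring

theorem degTrace_body2 (r : ℕ) (i j m n : Fin (M + 1)) :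
    degTrace (M + 1) r (mulX i * (mulX j * (partialD m * partialD n))) =
      bodyCoeff M r 2 * deltaPerm2 i j m n := by
  induction r with
  | zero => rw [degTrace_zero_mulX_mul, bodyCoeff_zero_succ, zero_mul]
  | succ r ih =>
    rw [degTrace_succ_mulX_mul]
    simp only [mul_assoc, partialD_mul_mulX, partialD_mul_mulX_mul, mul_add, mul_smul_comm,
      mul_one, map_add, map_smul, smul_eq_mul, degTrace_body1]
    rw [← mul_assoc (mulX j), mulX_comm j i, mul_assoc, ih, bodyCoeff_succ_succ, deltaPerm2]
    ring

theorem degTrace_body3 (r : ℕ) (i j k m n p : Fin (M + 1)) :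
    degTrace (M + 1) r
        (mulX i * (mulX j * (mulX k * (partialD m * (partialD n * partialD p))))) =
      bodyCoeff M r 3 * deltaPerm3 i j k m n p := by
  induction r with
  | zero => rw [degTrace_zero_mulX_mul, bodyCoeff_zero_succ, zero_mul]
  | succ r ih =>
    rw [degTrace_succ_mulX_mul]
    simp only [mul_assoc, partialD_mul_mulX, partialD_mul_mulX_mul, mul_add, mul_smul_comm,
      mul_one, map_add, map_smul, smul_eq_mul, degTrace_body2]
    have h : ∀ f : Module.End ℝ (MvPolynomial (Fin (M + 1)) ℝ),
        mulX j * (mulX k * (mulX i * f)) = mulX i * (mulX j * (mulX k * f)) := by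
      intro f
      rw [← mul_assoc (mulX k), mulX_comm k i, mul_assoc, ← mul_assoc, mulX_comm j i, mul_assoc]
    rw [h, ih, bodyCoeff_succ_succ, deltaPerm3]
    ring

theorem degTrace_body4 (r : ℕ) (i j k l m n p q : Fin (M + 1)) :
    degTrace (M + 1) r
        (mulX i * (mulX j * (mulX k * (mulX l *
          (partialD m * (partialD n * (partialD p * partialD q))))))) =
      bodyCoeff M r 4 * deltaPerm4 i j k l m n p q := by
  induction r with
  | zero => rw [degTrace_zero_mulX_mul, bodyCoeff_zero_succ, zero_mul]
  | succ r ih =>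
    rw [degTrace_succ_mulX_mul]
    simp only [mul_assoc, partialD_mul_mulX, partialD_mul_mulX_mul, mul_add, mul_smul_comm,
      mul_one, map_add, map_smul, smul_eq_mul, degTrace_body3]
    have h : ∀ f : Module.End ℝ (MvPolynomial (Fin (M + 1)) ℝ),
        mulX j * (mulX k * (mulX l * (mulX i * f))) =
          mulX i * (mulX j * (mulX k * (mulX l * f))) := by
      intro f
      rw [← mul_assoc (mulX l), mulX_comm l i, mul_assoc, ← mul_assoc (mulX k), mulX_comm k i,
        mul_assoc, ← mul_assoc, mulX_comm j i, mul_assoc]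
    rw [h, ih, bodyCoeff_succ_succ, deltaPerm4]
    ring

/-- Wick's theorem for x x ∂ ∂ x x ∂ ∂: the inner ∂ ∂ may contract with none, one (four ways) or
both (two ways) of the following x x, leaving 4-, 3- and 2-body operators. -/
theorem degTrace_normalOrder (r : ℕ) (i j m n k l p q : Fin (M + 1)) :
    degTrace (M + 1) r ((mulX i * (mulX j * (partialD m * partialD n))) *
        (mulX k * (mulX l * (partialD p * partialD q)))) =
      bodyCoeff M r 4 * deltaPerm4 i j k l m n p q +
      bodyCoeff M r 3 * (delta k n * deltaPerm3 i j l m p q + delta l n * deltaPerm3 i j k m p q +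
        delta k m * deltaPerm3 i j l n p q + delta l m * deltaPerm3 i j k n p q) +
      bodyCoeff M r 2 * (deltaPerm2 k l m n * deltaPerm2 i j p q) := by
  simp only [mul_assoc, partialD_mul_mulX_mul, mul_add, mul_smul_comm, map_add, map_smul,
    smul_eq_mul, degTrace_body2, degTrace_body3, degTrace_body4]
  rw [deltaPerm2.eq_def k l m n]
  ring

/-! ### Contractions with Kronecker deltas -/

theorem delta_comm (i j : Fin N) : delta i j = delta j i := by
  simp only [delta, eq_comm]

theorem sum_mul_delta (f : Fin N → ℝ) (i : Fin N) : ∑ m, f m * delta i m = f i := by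
  simp [delta]

theorem sum_mul_delta4 (H : Fin N → Fin N → Fin N → Fin N → ℝ) (i j k l : Fin N) :
    ∑ m, ∑ n, ∑ p, ∑ q, H m n p q * (delta i m * delta j n * delta k p * delta l q) =
      H i j k l := by
  simp only [← mul_assoc, sum_mul_delta]

theorem sum_mul_delta2 (H : Fin N → Fin N → ℝ) (i j : Fin N) :
    ∑ m, ∑ n, H m n * (delta i m * delta j n) = H i j := by
  simp only [← mul_assoc, sum_mul_delta]

theorem sum_mul_deltaPerm2 (H : Fin N → Fin N → ℝ) (i j : Fin N) :
    ∑ m, ∑ n, H m n * deltaPerm2 i j m n = H i j + H j i := by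
  have h : ∀ m n : Fin N, deltaPerm2 i j m n = delta i m * delta j n + delta j m * delta i n := by
    intro m n
    unfold deltaPerm2
    ring
  simp only [h, mul_add, Finset.sum_add_distrib, sum_mul_delta2]

theorem sum_mul_deltaPerm2_deltaPerm2 (H : Fin N → Fin N → Fin N → Fin N → ℝ) (i j k l : Fin N) :
    ∑ m, ∑ n, ∑ p, ∑ q, H m n p q * (deltaPerm2 m n i j * deltaPerm2 k l p q) =
      H i j k l + H i j l k + (H j i k l + H j i l k) := by
  have h : ∀ m n p q : Fin N, deltaPerm2 m n i j * deltaPerm2 k l p q =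
      delta i m * delta j n * delta k p * delta l q + delta i m * delta j n * delta l p * delta k q +
      (delta j m * delta i n * delta k p * delta l q +
        delta j m * delta i n * delta l p * delta k q) := by
    intro m n p q
    unfold deltaPerm2
    rw [delta_comm m i, delta_comm n j, delta_comm m j, delta_comm n i]
    ring
  simp only [h, mul_add, Finset.sum_add_distrib, sum_mul_delta4]

theorem sum_mul_delta_deltaPerm3 (H : Fin N → Fin N → Fin N → Fin N → ℝ) (h i j k : Fin N) :
    ∑ s, ∑ m, ∑ n, ∑ p, H s m n p * (delta s h * deltaPerm3 i j k m n p) =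
      H h i j k + H h i k j + (H h j i k + H h k i j) + (H h j k i + H h k j i) := by
  have e : ∀ s m n p : Fin N, delta s h * deltaPerm3 i j k m n p =
      delta h s * delta i m * delta j n * delta k p + delta h s * delta i m * delta k n * delta j p +
      (delta h s * delta j m * delta i n * delta k p +
        delta h s * delta k m * delta i n * delta j p) +
      (delta h s * delta j m * delta k n * delta i p +
        delta h s * delta k m * delta j n * delta i p) := by
    intro s m n p
    unfold deltaPerm3 deltaPerm2
    rw [delta_comm s h]
    ring
  simp only [e, mul_add, Finset.sum_add_distrib, sum_mul_delta4]

theorem sum_mul_deltaPerm4 (H : Fin N → Fin N → Fin N → Fin N → ℝ) (i j k l : Fin N) :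
    ∑ m, ∑ n, ∑ p, ∑ q, H m n p q * deltaPerm4 i j k l m n p q =
      H i j k l + H i j l k + H i k j l + H i k l j + H i l j k + H i l k j +
      (H j i k l + H j i l k + H j k i l + H j k l i + H j l i k + H j l k i) +
      (H k i j l + H k i l j + H k j i l + H k j l i + H k l i j + H k l j i) +
      (H l i j k + H l i k j + H l j i k + H l j k i + H l k i j + H l k j i) := by
  have e : ∀ m n p q : Fin N, deltaPerm4 i j k l m n p q =
      (fun a b c d => delta a m * delta b n * delta c p * delta d q) i j k l +
      (fun a b c d => delta a m * delta b n * delta c p * delta d q) i j l k +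
      (fun a b c d => delta a m * delta b n * delta c p * delta d q) i k j l +
      (fun a b c d => delta a m * delta b n * delta c p * delta d q) i k l j +
      (fun a b c d => delta a m * delta b n * delta c p * delta d q) i l j k +
      (fun a b c d => delta a m * delta b n * delta c p * delta d q) i l k j +
      ((fun a b c d => delta a m * delta b n * delta c p * delta d q) j i k l +
      (fun a b c d => delta a m * delta b n * delta c p * delta d q) j i l k +
      (fun a b c d => delta a m * delta b n * delta c p * delta d q) j k i l +
      (fun a b c d => delta a m * delta b n * delta c p * delta d q) j k l i +
      (fun a b c d => delta a m * delta b n * delta c p * delta d q) j l i k +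
      (fun a b c d => delta a m * delta b n * delta c p * delta d q) j l k i) +
      ((fun a b c d => delta a m * delta b n * delta c p * delta d q) k i j l +
      (fun a b c d => delta a m * delta b n * delta c p * delta d q) k i l j +
      (fun a b c d => delta a m * delta b n * delta c p * delta d q) k j i l +
      (fun a b c d => delta a m * delta b n * delta c p * delta d q) k j l i +
      (fun a b c d => delta a m * delta b n * delta c p * delta d q) k l i j +
      (fun a b c d => delta a m * delta b n * delta c p * delta d q) k l j i) +
      ((fun a b c d => delta a m * delta b n * delta c p * delta d q) l i j k +
      (fun a b c d => delta a m * delta b n * delta c p * delta d q) l i k j +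
      (fun a b c d => delta a m * delta b n * delta c p * delta d q) l j i k +
      (fun a b c d => delta a m * delta b n * delta c p * delta d q) l j k i +
      (fun a b c d => delta a m * delta b n * delta c p * delta d q) l k i j +
      (fun a b c d => delta a m * delta b n * delta c p * delta d q) l k j i) := by
    intro m n p q
    unfold deltaPerm4 deltaPerm3 deltaPerm2
    ring
  simp only [e, mul_add, Finset.sum_add_distrib, sum_mul_delta4]

theorem sum_swap_pairs (f : Fin N → Fin N → Fin N → Fin N → ℝ) :
    ∑ m, ∑ n, ∑ k, ∑ l, f m n k l = ∑ k, ∑ l, ∑ m, ∑ n, f m n k l := by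
  have h := Finset.sum_comm (s := (Finset.univ : Finset (Fin N × Fin N)))
    (t := (Finset.univ : Finset (Fin N × Fin N))) (f := fun x y => f x.1 x.2 y.1 y.2)
  simpa only [Fintype.sum_prod_type] using h

theorem sum_swap_first_last (f : Fin N → Fin N → Fin N → Fin N → ℝ) :
    ∑ m, ∑ n, ∑ k, ∑ l, f m n k l = ∑ l, ∑ n, ∑ k, ∑ m, f m n k l := by
  have h : ∑ m, ∑ y : Fin N × Fin N, ∑ l, f m y.1 y.2 l =
      ∑ l, ∑ y : Fin N × Fin N, ∑ m, f m y.1 y.2 l := by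
    rw [Finset.sum_comm]
    simp only [Finset.sum_comm (f := fun m l => f m _ _ l)]
    rw [Finset.sum_comm]
  simpa only [Fintype.sum_prod_type] using h

/-! ### The three invariants and the traces of D and D² -/

/-- The partial trace `λ_{ijkk}`. -/
noncomputable def partialTrace (lam : SymTensor N 4) (i j : Fin N) : ℝ := ∑ k, comp4 lam i j k k

/-- The full trace `λ_{iijj}`. -/
noncomputable def fullTrace (lam : SymTensor N 4) : ℝ := ∑ i, partialTrace lam i i

/-- The squared norm `λ_{ijkk} λ_{ijll}` of the partial trace. -/
noncomputable def traceNormSq (lam : SymTensor N 4) : ℝ := ∑ i, ∑ j, partialTrace lam i j ^ 2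

/-- The squared norm `λ_{ijkl} λ_{ijkl}`. -/
noncomputable def normSq (lam : SymTensor N 4) : ℝ :=
  ∑ i, ∑ j, ∑ k, ∑ l, comp4 lam i j k l ^ 2

theorem partialTrace_comm (lam : SymTensor N 4) (i j : Fin N) :
    partialTrace lam i j = partialTrace lam j i :=
  Finset.sum_congr rfl fun k _ => comp4_swap12 lam i j k k

theorem comp4_rotate (lam : SymTensor N 4) (i j k : Fin N) :
    comp4 lam i k j k = comp4 lam i j k k := comp4_swap23 lam i k j k

theorem sum_comp4_pair (lam : SymTensor N 4) :
    ∑ i, ∑ j, comp4 lam i j i j = fullTrace lam := by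
  refine Finset.sum_congr rfl fun i _ => Finset.sum_congr rfl fun j _ => ?_
  exact comp4_rotate lam i i j

theorem sum_comp4_mul_comp4_self (lam : SymTensor N 4) :
    ∑ i, ∑ j, ∑ k, ∑ l, comp4 lam i j k l * comp4 lam k l i j = normSq lam := by
  refine Finset.sum_congr rfl fun i _ => Finset.sum_congr rfl fun j _ =>
    Finset.sum_congr rfl fun k _ => Finset.sum_congr rfl fun l _ => ?_
  rw [comp4_swap_pairs lam k l i j, sq]

theorem sum_comp4_mul_comp4_trace (lam : SymTensor N 4) :
    ∑ i, ∑ j, ∑ k, ∑ l, comp4 lam i j i k * comp4 lam k l j l = traceNormSq lam := by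
  rw [Finset.sum_comm]
  refine Finset.sum_congr rfl fun j _ => ?_
  rw [Finset.sum_comm]
  refine Finset.sum_congr rfl fun k _ => ?_
  simp only [← Finset.mul_sum, ← Finset.sum_mul]
  rw [sq]
  congr 1
  · refine Finset.sum_congr rfl fun i _ => ?_
    rw [comp4_swap12, comp4_swap34, comp4_rotate]
  · refine Finset.sum_congr rfl fun l _ => ?_
    rw [comp4_rotate, comp4_swap12]

theorem degTrace_dilatation (lam : SymTensor (M + 1) 4) (r : ℕ) :
    degTrace (M + 1) r (dilatation (comp4 lam)) = bodyCoeff M r 2 * fullTrace lam := by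
  simp only [dilatation, map_smul, map_sum, degTrace_body2, smul_eq_mul]
  have h : ∀ i j : Fin (M + 1),
      ∑ m, ∑ n, comp4 lam i j m n * (bodyCoeff M r 2 * deltaPerm2 i j m n) =
        2 * bodyCoeff M r 2 * comp4 lam i j i j := by
    intro i j
    have e := sum_mul_deltaPerm2 (fun m n => comp4 lam i j m n * bodyCoeff M r 2) i j
    simp only [mul_assoc] at e
    rw [e, comp4_swap34 lam i j j i]
    ring
  simp only [h, ← Finset.mul_sum, sum_comp4_pair]
  ring

/-- Of the 24 matchings, 4 close each λ on itself (a²), 16 join the two λ by two index pairs (q),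
and 4 join them by all four (S). -/
theorem sum_comp4_deltaPerm4 (lam : SymTensor N 4) :
    ∑ i, ∑ j, ∑ m, ∑ n, ∑ k, ∑ l, ∑ p, ∑ q,
      comp4 lam i j m n * (comp4 lam k l p q * deltaPerm4 i j k l m n p q) =
      4 * (fullTrace lam ^ 2 + 4 * traceNormSq lam + normSq lam) := by
  have h : ∀ i j k l : Fin N, ∑ m, ∑ n, ∑ p, ∑ q,
      comp4 lam i j m n * (comp4 lam k l p q * deltaPerm4 i j k l m n p q) =
      4 * (comp4 lam i j i j * comp4 lam k l k l + comp4 lam i j i k * comp4 lam k l j l +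
        comp4 lam i j i l * comp4 lam l k j k + comp4 lam j i j k * comp4 lam k l i l +
        comp4 lam j i j l * comp4 lam l k i k + comp4 lam i j k l * comp4 lam k l i j) := by
    intro i j k l
    have e := sum_mul_deltaPerm4 (fun m n p q => comp4 lam i j m n * comp4 lam k l p q) i j k l
    simp only [mul_assoc] at e
    rw [e]
    simp only [comp4_swap34 lam i j j i, comp4_swap34 lam i j k i, comp4_swap34 lam i j l i,
      comp4_swap34 lam i j k j, comp4_swap34 lam i j l j, comp4_swap34 lam i j l k,
      comp4_swap34 lam k l j i, comp4_swap34 lam k l k i, comp4_swap34 lam k l l i,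
      comp4_swap34 lam k l k j, comp4_swap34 lam k l l j, comp4_swap34 lam k l l k,
      comp4_swap12 lam j i, comp4_swap12 lam l k]
    ring
  have h2 : ∀ i j : Fin N, ∑ m, ∑ n, ∑ k, ∑ l, ∑ p, ∑ q,
      comp4 lam i j m n * (comp4 lam k l p q * deltaPerm4 i j k l m n p q) =
      ∑ k, ∑ l, ∑ m, ∑ n, ∑ p, ∑ q,
      comp4 lam i j m n * (comp4 lam k l p q * deltaPerm4 i j k l m n p q) := by
    intro i j
    exact sum_swap_pairs fun m n k l => ∑ p, ∑ q,
      comp4 lam i j m n * (comp4 lam k l p q * deltaPerm4 i j k l m n p q)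
  have t1 : ∑ i, ∑ j, ∑ k, ∑ l, comp4 lam i j i j * comp4 lam k l k l = fullTrace lam ^ 2 := by
    simp only [← Finset.mul_sum, sum_comp4_pair, ← Finset.sum_mul, sq]
  have t2 := sum_comp4_mul_comp4_trace lam
  have t3 : ∑ i, ∑ j, ∑ k, ∑ l, comp4 lam i j i l * comp4 lam l k j k = traceNormSq lam := by
    rw [← t2]
    exact Finset.sum_congr rfl fun i _ => Finset.sum_congr rfl fun j _ => Finset.sum_comm
  have t4 : ∑ i, ∑ j, ∑ k, ∑ l, comp4 lam j i j k * comp4 lam k l i l = traceNormSq lam := by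
    rw [← t2]
    exact Finset.sum_comm
  have t5 : ∑ i, ∑ j, ∑ k, ∑ l, comp4 lam j i j l * comp4 lam l k i k = traceNormSq lam := by
    rw [← t3]
    exact Finset.sum_comm
  have t6 := sum_comp4_mul_comp4_self lam
  simp only [h2, h]
  simp only [← Finset.mul_sum, Finset.sum_add_distrib]
  simp only [← Finset.mul_sum] at t1 t2 t3 t4 t5 t6
  rw [t1, t2, t3, t4, t5, t6]
  ring

/-- With one index pair already joining the two λ, the six matchings of the rest split into 4 giving
q and 2 giving S. -/
theorem sum_comp4_delta_deltaPerm3 (lam : SymTensor N 4) :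
    ∑ i, ∑ j, ∑ m, ∑ n, ∑ k, ∑ l, ∑ p, ∑ q,
      comp4 lam i j m n * (comp4 lam k l p q * (delta k n * deltaPerm3 i j l m p q)) =
      2 * (2 * traceNormSq lam + normSq lam) := by
  have h : ∀ i j l n : Fin N, ∑ k, ∑ m, ∑ p, ∑ q,
      comp4 lam i j m n * (comp4 lam k l p q * (delta k n * deltaPerm3 i j l m p q)) =
      2 * (comp4 lam i j i n * comp4 lam n l j l + comp4 lam j i j n * comp4 lam n l i l +
        comp4 lam i j l n * comp4 lam l n i j) := by
    intro i j l n
    have e := sum_mul_delta_deltaPerm3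
      (fun k m p q => comp4 lam i j m n * comp4 lam k l p q) n i j l
    simp only [mul_assoc] at e
    rw [e, comp4_swap34 lam n l l j, comp4_swap34 lam n l l i, comp4_swap34 lam n l j i,
      comp4_swap12 lam n l i j, comp4_swap12 lam i j j n]
    ring
  have h2 : ∀ i j : Fin N, ∑ m, ∑ n, ∑ k, ∑ l, ∑ p, ∑ q,
      comp4 lam i j m n * (comp4 lam k l p q * (delta k n * deltaPerm3 i j l m p q)) =
      ∑ l, ∑ n, ∑ k, ∑ m, ∑ p, ∑ q,
      comp4 lam i j m n * (comp4 lam k l p q * (delta k n * deltaPerm3 i j l m p q)) := by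
    intro i j
    exact sum_swap_first_last fun m n k l => ∑ p, ∑ q,
      comp4 lam i j m n * (comp4 lam k l p q * (delta k n * deltaPerm3 i j l m p q))
  have t1 : ∑ i, ∑ j, ∑ l, ∑ n, comp4 lam i j i n * comp4 lam n l j l = traceNormSq lam := by
    rw [← sum_comp4_mul_comp4_trace lam]
    exact Finset.sum_congr rfl fun i _ => Finset.sum_congr rfl fun j _ => Finset.sum_comm
  have t2 : ∑ i, ∑ j, ∑ l, ∑ n, comp4 lam j i j n * comp4 lam n l i l = traceNormSq lam := by
    rw [← t1]
    exact Finset.sum_comm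
  have t3 := sum_comp4_mul_comp4_self lam
  simp only [h2, h]
  simp only [← Finset.mul_sum, Finset.sum_add_distrib]
  rw [t1, t2, t3]
  ring

theorem sum_comp4_deltaPerm2 (lam : SymTensor N 4) :
    ∑ i, ∑ j, ∑ m, ∑ n, ∑ k, ∑ l, ∑ p, ∑ q,
      comp4 lam i j m n * (comp4 lam k l p q * (deltaPerm2 k l m n * deltaPerm2 i j p q)) =
      4 * normSq lam := by
  have h : ∀ i j m n : Fin N, ∑ k, ∑ l, ∑ p, ∑ q,
      comp4 lam i j m n * (comp4 lam k l p q * (deltaPerm2 k l m n * deltaPerm2 i j p q)) =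
      4 * (comp4 lam i j m n * comp4 lam m n i j) := by
    intro i j m n
    have e := sum_mul_deltaPerm2_deltaPerm2
      (fun k l p q => comp4 lam i j m n * comp4 lam k l p q) m n i j
    simp only [mul_assoc] at e
    rw [e, comp4_swap34 lam m n j i, comp4_swap34 lam n m j i, comp4_swap12 lam n m i j]
    ring
  simp only [h]
  simp only [← Finset.mul_sum, sum_comp4_mul_comp4_self]

theorem sum8_linear (a b c : ℝ)
    (f g₁ g₂ g₃ g₄ h : Fin N → Fin N → Fin N → Fin N → Fin N → Fin N → Fin N → Fin N → ℝ) :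
    ∑ i, ∑ j, ∑ m, ∑ n, ∑ k, ∑ l, ∑ p, ∑ q, (a * f i j m n k l p q +
      b * (g₁ i j m n k l p q + g₂ i j m n k l p q + g₃ i j m n k l p q + g₄ i j m n k l p q) +
      c * h i j m n k l p q) =
    a * (∑ i, ∑ j, ∑ m, ∑ n, ∑ k, ∑ l, ∑ p, ∑ q, f i j m n k l p q) +
    b * ((∑ i, ∑ j, ∑ m, ∑ n, ∑ k, ∑ l, ∑ p, ∑ q, g₁ i j m n k l p q) +
      (∑ i, ∑ j, ∑ m, ∑ n, ∑ k, ∑ l, ∑ p, ∑ q, g₂ i j m n k l p q) +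
      (∑ i, ∑ j, ∑ m, ∑ n, ∑ k, ∑ l, ∑ p, ∑ q, g₃ i j m n k l p q) +
      (∑ i, ∑ j, ∑ m, ∑ n, ∑ k, ∑ l, ∑ p, ∑ q, g₄ i j m n k l p q)) +
    c * (∑ i, ∑ j, ∑ m, ∑ n, ∑ k, ∑ l, ∑ p, ∑ q, h i j m n k l p q) := by
  simp only [Finset.sum_add_distrib, ← Finset.mul_sum]

theorem degTrace_dilatation_sq (lam : SymTensor (M + 1) 4) (r : ℕ) :
    degTrace (M + 1) r (dilatation (comp4 lam) * dilatation (comp4 lam)) =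
      bodyCoeff M r 4 * (fullTrace lam ^ 2 + 4 * traceNormSq lam + normSq lam) +
      bodyCoeff M r 3 * (4 * traceNormSq lam + 2 * normSq lam) +
      bodyCoeff M r 2 * normSq lam := by
  have e : degTrace (M + 1) r (dilatation (comp4 lam) * dilatation (comp4 lam)) =
      1 / 4 * ∑ i, ∑ j, ∑ m, ∑ n, ∑ k, ∑ l, ∑ p, ∑ q,
        comp4 lam i j m n * (comp4 lam k l p q *
          degTrace (M + 1) r ((mulX i * (mulX j * (partialD m * partialD n))) *
            (mulX k * (mulX l * (partialD p * partialD q))))) := by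
    simp only [dilatation, smul_mul_smul_comm, Finset.sum_mul]
    simp only [Finset.mul_sum, smul_mul_assoc, mul_smul_comm, map_smul, map_sum, smul_eq_mul]
    refine Finset.sum_congr rfl fun i _ => Finset.sum_congr rfl fun j _ =>
      Finset.sum_congr rfl fun m _ => Finset.sum_congr rfl fun n _ => Finset.sum_congr rfl fun k _ =>
      Finset.sum_congr rfl fun l _ => Finset.sum_congr rfl fun p _ => Finset.sum_congr rfl
      fun q _ => ?_
    ring
  -- The four single contractions agree by the symmetry of λ within each pair of indices; they are
  -- all reduced to the one with δ_{kn}.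
  have s2 : ∀ i j m n : Fin (M + 1), ∑ k, ∑ l, ∑ p, ∑ q,
      comp4 lam i j m n * (comp4 lam k l p q * (delta l n * deltaPerm3 i j k m p q)) =
      ∑ k, ∑ l, ∑ p, ∑ q,
      comp4 lam i j m n * (comp4 lam k l p q * (delta k n * deltaPerm3 i j l m p q)) := by
    intro i j m n
    rw [Finset.sum_comm]
    refine Finset.sum_congr rfl fun k _ => Finset.sum_congr rfl fun l _ => ?_
    simp only [comp4_swap12 lam l k]
  have s3 : ∀ i j : Fin (M + 1), ∑ m, ∑ n, ∑ k, ∑ l, ∑ p, ∑ q,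
      comp4 lam i j m n * (comp4 lam k l p q * (delta k m * deltaPerm3 i j l n p q)) =
      ∑ m, ∑ n, ∑ k, ∑ l, ∑ p, ∑ q,
      comp4 lam i j m n * (comp4 lam k l p q * (delta k n * deltaPerm3 i j l m p q)) := by
    intro i j
    rw [Finset.sum_comm]
    refine Finset.sum_congr rfl fun m _ => Finset.sum_congr rfl fun n _ => ?_
    rw [comp4_swap34 lam i j n m]
  have s4 : ∀ i j m n : Fin (M + 1), ∑ k, ∑ l, ∑ p, ∑ q,
      comp4 lam i j m n * (comp4 lam k l p q * (delta l m * deltaPerm3 i j k n p q)) =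
      ∑ k, ∑ l, ∑ p, ∑ q,
      comp4 lam i j m n * (comp4 lam k l p q * (delta k m * deltaPerm3 i j l n p q)) := by
    intro i j m n
    rw [Finset.sum_comm]
    refine Finset.sum_congr rfl fun k _ => Finset.sum_congr rfl fun l _ => ?_
    simp only [comp4_swap12 lam l k]
  have pt : ∀ i j m n k l p q : Fin (M + 1), comp4 lam i j m n * (comp4 lam k l p q *
      degTrace (M + 1) r ((mulX i * (mulX j * (partialD m * partialD n))) *
        (mulX k * (mulX l * (partialD p * partialD q))))) =
      bodyCoeff M r 4 *
        (comp4 lam i j m n * (comp4 lam k l p q * deltaPerm4 i j k l m n p q)) +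
      bodyCoeff M r 3 *
        (comp4 lam i j m n * (comp4 lam k l p q * (delta k n * deltaPerm3 i j l m p q)) +
        comp4 lam i j m n * (comp4 lam k l p q * (delta l n * deltaPerm3 i j k m p q)) +
        comp4 lam i j m n * (comp4 lam k l p q * (delta k m * deltaPerm3 i j l n p q)) +
        comp4 lam i j m n * (comp4 lam k l p q * (delta l m * deltaPerm3 i j k n p q))) +
      bodyCoeff M r 2 *
        (comp4 lam i j m n * (comp4 lam k l p q * (deltaPerm2 k l m n * deltaPerm2 i j p q))) := by
    intro i j m n k l p q
    rw [degTrace_normalOrder]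
    ring
  rw [e]
  simp only [pt]
  rw [sum8_linear, sum_comp4_deltaPerm4, sum_comp4_deltaPerm2]
  simp only [s2, s4]
  simp only [s3]
  rw [sum_comp4_delta_deltaPerm3]
  ring

/-! ### From traces to eigenvalue averages -/

/-- The spectral theorem, stated for a bare vector space with the inner product as data, so that the
norm it induces does not clash with the sup norm that spaces of tensors already carry. -/
theorem exists_roots_charpoly_of_selfAdjoint {V : Type*} [AddCommGroup V] [Module ℝ V]
    [FiniteDimensional ℝ V] (B : InnerProductSpace.Core ℝ V) (f : Module.End ℝ V)
    (hf : ∀ x y, B.inner (f x) y = B.inner x (f y)) :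
    ∃ μ : Fin (Module.finrank ℝ V) → ℝ,
      f.charpoly.roots = Multiset.map μ Finset.univ.val ∧ LinearMap.trace ℝ V f = ∑ k, μ k ∧
        LinearMap.trace ℝ V (f * f) = ∑ k, μ k ^ 2 := by
  let _ : NormedAddCommGroup V := B.toNormedAddCommGroup
  let _ : InnerProductSpace ℝ V := InnerProductSpace.ofCore B.toCore
  have hs : LinearMap.IsSymmetric f := hf
  let b := (hs.eigenvectorBasis rfl).toBasis
  have hb : LinearMap.toMatrix b b f = Matrix.diagonal (hs.eigenvalues rfl) := by
    simpa using hs.toMatrix_eigenvectorBasis rfl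
  refine ⟨hs.eigenvalues rfl, ?_, ?_, ?_⟩
  · simpa using hs.roots_charpoly_eq_eigenvalues rfl
  · rw [LinearMap.trace_eq_matrix_trace ℝ b, hb, Matrix.trace_diagonal]
  · rw [LinearMap.trace_eq_matrix_trace ℝ b, LinearMap.toMatrix_mul, hb,
      Matrix.diagonal_mul_diagonal, Matrix.trace_diagonal]
    simp only [sq]

theorem sum_symmetrize_mul {r : ℕ} (A : Tensor N r) {C : Tensor N r} (hC : C ∈ SymTensor N r) :
    ∑ i, symmetrize A i * C i = ∑ i, A i * C i := by
  have key : ∀ σ : Equiv.Perm (Fin r), ∑ i, A (i ∘ σ) * C i = ∑ i, A i * C i := by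
    intro σ
    refine Fintype.sum_equiv (σ.symm.arrowCongr (Equiv.refl _)) _ _ fun i => ?_
    have h : (σ.symm.arrowCongr (Equiv.refl (Fin N))) i = i ∘ σ := rfl
    rw [h, hC σ i]
  have h : ∀ i, symmetrize A i * C i =
      (1 / (r.factorial : ℝ)) * ∑ σ : Equiv.Perm (Fin r), A (i ∘ σ) * C i := by
    intro i
    simp only [symmetrize, LinearMap.coe_mk, AddHom.coe_mk, Finset.sum_mul, mul_assoc]
  simp only [h]
  rw [← Finset.mul_sum, Finset.sum_comm, Finset.sum_congr rfl fun σ _ => key σ, Finset.sum_const,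
    Finset.card_univ, Fintype.card_perm, Fintype.card_fin, nsmul_eq_mul, ← mul_assoc,
    one_div_mul_cancel (by positivity), one_mul]

theorem sum_contract_mul {s : ℕ} (lam : SymTensor N 4) (B C : SymTensor N (s + 2)) :
    ∑ i, contract lam.1 B.1 i * C.1 i = ∑ i, ∑ j, ∑ m, ∑ n, comp4 lam i j m n *
      ∑ t : Fin s → Fin N, B.1 (Fin.cons m (Fin.cons n t)) * C.1 (Fin.cons i (Fin.cons j t)) := by
  simp only [sum_tensor_succ]
  refine Finset.sum_congr rfl fun i _ => Finset.sum_congr rfl fun j _ => ?_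
  simp only [Finset.mul_sum]
  have h : ∀ t : Fin s → Fin N, contract lam.1 B.1 (Fin.cons i (Fin.cons j t)) =
      ∑ m, ∑ n, comp4 lam i j m n * B.1 (Fin.cons m (Fin.cons n t)) := by
    intro t
    refine Finset.sum_congr rfl fun m _ => Finset.sum_congr rfl fun n _ => ?_
    rw [apply_snoc B.2, apply_snoc (slice_mem B.2 n), apply_cons_swap B.2, comp4_swap_pairs]
    rfl
  simp only [h, Finset.sum_mul, mul_assoc]
  rw [Finset.sum_comm]
  exact Finset.sum_congr rfl fun m _ => Finset.sum_comm

/-- The inner product `A_{i₁ … i_r} B_{i₁ … i_r}` of symmetric tensors. -/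
@[reducible]
noncomputable def tensorInner (N r : ℕ) : InnerProductSpace.Core ℝ (SymTensor N r) where
  inner A B := ∑ i, A.1 i * B.1 i
  conj_inner_symm A B := by
    simp [mul_comm]
  re_inner_nonneg A := by
    simpa using Finset.sum_nonneg fun i _ => mul_self_nonneg (A.1 i)
  add_left A B C := by
    simp [add_mul, Finset.sum_add_distrib]
  smul_left A B c := by
    simp [Finset.mul_sum, mul_assoc]
  definite A h := by
    refine Subtype.ext (funext fun i => ?_)
    have := (Finset.sum_eq_zero_iff_of_nonneg fun i _ => mul_self_nonneg (A.1 i)).mp h i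
      (Finset.mem_univ i)
    simpa using this

/-- Symmetrization is an orthogonal projection, so it drops out against a symmetric tensor; what
remains is symmetric because λ_{ijmn} = λ_{mnij}. -/
theorem anomalousOp_selfAdjoint {s : ℕ} (lam : SymTensor N 4) (B C : SymTensor N (s + 2)) :
    (tensorInner N (s + 2)).inner (anomalousOp lam (s + 2) B) C =
      (tensorInner N (s + 2)).inner B (anomalousOp lam (s + 2) C) := by
  show ∑ i, ((((s + 2 : ℕ) : ℝ) * (((s + 2 : ℕ) : ℝ) - 1) / 2) *
      symmetrize (contract lam.1 B.1) i) * C.1 i =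
    ∑ i, B.1 i * ((((s + 2 : ℕ) : ℝ) * (((s + 2 : ℕ) : ℝ) - 1) / 2) *
      symmetrize (contract lam.1 C.1) i)
  have h : ∀ i (c : ℝ), B.1 i * (c * symmetrize (contract lam.1 C.1) i) =
      c * (symmetrize (contract lam.1 C.1) i * B.1 i) := fun i c => by ring
  simp only [h, mul_assoc, ← Finset.mul_sum]
  rw [sum_symmetrize_mul _ C.2, sum_symmetrize_mul _ B.2, sum_contract_mul, sum_contract_mul,
    sum_swap_pairs]
  refine congrArg _ ?_
  refine Finset.sum_congr rfl fun i _ => Finset.sum_congr rfl fun j _ =>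
    Finset.sum_congr rfl fun m _ => Finset.sum_congr rfl fun n _ => ?_
  rw [comp4_swap_pairs]
  simp only [mul_comm (B.1 _)]

theorem trace_anomalousOp (lam : SymTensor N 4) (s : ℕ) :
    LinearMap.trace ℝ _ (anomalousOp lam (s + 2)) =
      degTrace N (s + 2) (dilatation (comp4 lam)) := by
  rw [← LinearMap.trace_conj' _ (toPolyEquiv N (s + 2))]
  symm
  apply degTrace_eq_trace
  intro p
  obtain ⟨B, rfl⟩ := (toPolyEquiv N (s + 2)).surjective p
  rw [LinearEquiv.conj_apply_apply, LinearEquiv.symm_apply_apply]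
  exact toPoly_anomalousOp lam B

theorem trace_anomalousOp_sq (lam : SymTensor N 4) (s : ℕ) :
    LinearMap.trace ℝ _ (anomalousOp lam (s + 2) * anomalousOp lam (s + 2)) =
      degTrace N (s + 2) (dilatation (comp4 lam) * dilatation (comp4 lam)) := by
  rw [← LinearMap.trace_conj' _ (toPolyEquiv N (s + 2))]
  symm
  apply degTrace_eq_trace
  intro p
  obtain ⟨B, rfl⟩ := (toPolyEquiv N (s + 2)).surjective p
  rw [LinearEquiv.conj_apply_apply, LinearEquiv.symm_apply_apply, Module.End.mul_apply,
    Module.End.mul_apply, toPolyEquiv_coe, toPolyEquiv_coe, toPoly_anomalousOp, toPoly_anomalousOp]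

theorem numOps_eq_bodyCoeff (M r : ℕ) : (numOps (M + 1) r : ℝ) = bodyCoeff M r 0 := by
  unfold numOps bodyCoeff
  rw [Nat.choose_symm_of_eq_add (show M + r = (M + 0) + r by omega)]
  congr 2
  omega

theorem finrank_symTensor (M r : ℕ) : Module.finrank ℝ (SymTensor (M + 1) r) = numOps (M + 1) r := by
  have h : (Module.finrank ℝ (SymTensor (M + 1) r) : ℝ) = numOps (M + 1) r := by
    rw [numOps_eq_bodyCoeff, ← degTrace_one, (toPolyEquiv (M + 1) r).finrank_eq,
      degTrace_eq_trace 1 1 fun p => rfl, LinearMap.trace_one]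
  exact_mod_cast h

theorem card_anomalousDims (lam : SymTensor (M + 1) 4) (s : ℕ) :
    (anomalousDims lam (s + 2)).card = numOps (M + 1) (s + 2) := by
  obtain ⟨μ, h, -⟩ := exists_roots_charpoly_of_selfAdjoint (tensorInner (M + 1) (s + 2))
    (anomalousOp lam (s + 2)) (anomalousOp_selfAdjoint lam)
  rw [anomalousDims, h, ← finrank_symTensor]
  simp

/-- The product `∏_{j < k} (r - j) / (N + j)`. -/
noncomputable def bodyRatio (N r k : ℕ) : ℝ :=
  ∏ j ∈ Finset.range k, ((r : ℝ) - j) / ((N : ℝ) + j)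

theorem bodyCoeff_pos (M r : ℕ) : 0 < bodyCoeff M r 0 := by
  unfold bodyCoeff
  exact_mod_cast Nat.choose_pos (by omega)

theorem bodyCoeff_eq (M r k : ℕ) : bodyCoeff M r k = bodyRatio (M + 1) r k * bodyCoeff M r 0 := by
  induction k with
  | zero => simp [bodyRatio]
  | succ k ih =>
    rw [bodyRatio, Finset.prod_range_succ, ← bodyRatio, mul_right_comm, ← ih]
    have h : bodyCoeff M r (k + 1) * (M + k + 1) = bodyCoeff M r k * (r - k) := by
      unfold bodyCoeff
      rcases le_or_gt k r with hk | hk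
      · have h := Nat.choose_succ_right_eq (M + r) (M + k)
        have e : M + r - (M + k) = r - k := by omega
        rw [e] at h
        have h2 := congrArg (Nat.cast : ℕ → ℝ) h
        push_cast [Nat.cast_sub hk] at h2
        exact h2
      · rw [Nat.choose_eq_zero_of_lt (by omega : M + r < M + (k + 1)),
          Nat.choose_eq_zero_of_lt (by omega : M + r < M + k)]
        simp
    have h0 : ((M + 1 : ℕ) : ℝ) + k ≠ 0 := by positivity
    rw [mul_div_assoc', eq_div_iff h0, ← h]
    push_cast
    ring

theorem avgGamma_one (lam : SymTensor (M + 1) 4) (s : ℕ) :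
    avgGamma lam 1 (s + 2) = bodyRatio (M + 1) (s + 2) 2 * fullTrace lam := by
  obtain ⟨μ, h, h1, -⟩ := exists_roots_charpoly_of_selfAdjoint (tensorInner (M + 1) (s + 2))
    (anomalousOp lam (s + 2)) (anomalousOp_selfAdjoint lam)
  rw [trace_anomalousOp, degTrace_dilatation, bodyCoeff_eq] at h1
  have h2 : ((anomalousDims lam (s + 2)).map fun γ => γ ^ 1).sum = ∑ k, μ k := by
    rw [anomalousDims, h, Multiset.map_map]
    simp [Finset.sum]
  rw [avgGamma, h2, ← h1, numOps_eq_bodyCoeff]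
  have := (bodyCoeff_pos M (s + 2)).ne'
  field_simp

theorem avgGamma_two (lam : SymTensor (M + 1) 4) (s : ℕ) :
    avgGamma lam 2 (s + 2) =
      bodyRatio (M + 1) (s + 2) 4 * (fullTrace lam ^ 2 + 4 * traceNormSq lam + normSq lam) +
      bodyRatio (M + 1) (s + 2) 3 * (4 * traceNormSq lam + 2 * normSq lam) +
      bodyRatio (M + 1) (s + 2) 2 * normSq lam := by
  obtain ⟨μ, h, -, h1⟩ := exists_roots_charpoly_of_selfAdjoint (tensorInner (M + 1) (s + 2))
    (anomalousOp lam (s + 2)) (anomalousOp_selfAdjoint lam)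
  rw [trace_anomalousOp_sq, degTrace_dilatation_sq, bodyCoeff_eq M _ 4, bodyCoeff_eq M _ 3,
    bodyCoeff_eq M _ 2] at h1
  have h2 : ((anomalousDims lam (s + 2)).map fun γ => γ ^ 2).sum = ∑ k, μ k ^ 2 := by
    rw [anomalousDims, h, Multiset.map_map]
    simp [Finset.sum]
  rw [avgGamma, h2, ← h1, numOps_eq_bodyCoeff]
  have := (bodyCoeff_pos M (s + 2)).ne'
  field_simp

/-! ### Components of the O(N) tensor -/

theorem mem_symTensor_of_swap {r : ℕ} {A : Tensor N r}
    (h : ∀ (x y : Fin r) (i : Fin r → Fin N), A (i ∘ Equiv.swap x y) = A i) :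
    A ∈ SymTensor N r := by
  intro σ
  induction σ using Equiv.Perm.swap_induction_on with
  | one => exact fun i => rfl
  | swap_mul f x y _ ih =>
    intro i
    have e : i ∘ ⇑(Equiv.swap x y * f) = (i ∘ Equiv.swap x y) ∘ f := rfl
    rw [e, ih, h]

theorem symmetrize_of_mem {r : ℕ} {A : Tensor N r} (hA : A ∈ SymTensor N r) :
    symmetrize A = A := by
  funext i
  show (1 / (r.factorial : ℝ)) * ∑ σ : Equiv.Perm (Fin r), A (i ∘ σ) = A i
  simp only [hA _ i, Finset.sum_const, Finset.card_univ, Fintype.card_perm, Fintype.card_fin,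
    nsmul_eq_mul]
  rw [← mul_assoc, one_div_mul_cancel (by positivity), one_mul]

theorem symmetrize_comp {r : ℕ} (A : Tensor N r) (τ : Equiv.Perm (Fin r)) :
    symmetrize (fun i => A (i ∘ τ)) = symmetrize A := by
  funext i
  show (1 / (r.factorial : ℝ)) * ∑ σ : Equiv.Perm (Fin r), A ((i ∘ σ) ∘ τ) =
    (1 / (r.factorial : ℝ)) * ∑ σ : Equiv.Perm (Fin r), A (i ∘ σ)
  congr 1
  exact Fintype.sum_equiv (Equiv.mulRight τ) _ _ fun σ => rfl

theorem delta_pairings_mem (N : ℕ) : (fun i => delta (i 0) (i 1) * delta (i 2) (i 3) +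
    delta (i 0) (i 2) * delta (i 1) (i 3) + delta (i 0) (i 3) * delta (i 1) (i 2) : Tensor N 4) ∈
      SymTensor N 4 := by
  refine mem_symTensor_of_swap fun x y i => ?_
  have h10 := delta_comm (i 1) (i 0)
  have h20 := delta_comm (i 2) (i 0)
  have h30 := delta_comm (i 3) (i 0)
  have h21 := delta_comm (i 2) (i 1)
  have h31 := delta_comm (i 3) (i 1)
  have h32 := delta_comm (i 3) (i 2)
  fin_cases x <;> fin_cases y <;>
    simp [Equiv.swap_apply_def, h10, h20, h30, h21, h31, h32] <;> ring

theorem comp4_couplingON (i j k l : Fin N) : comp4 (couplingON N) i j k l =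
    1 / ((N : ℝ) + 8) * (delta i j * delta k l + delta i k * delta j l + delta i l * delta j k) := by
  have h : symmetrize (fun i : Fin 4 → Fin N =>
        3 / ((N : ℝ) + 8) * (delta (i 0) (i 1) * delta (i 2) (i 3))) =
      (1 / ((N : ℝ) + 8)) • fun i : Fin 4 → Fin N => (delta (i 0) (i 1) * delta (i 2) (i 3) +
        delta (i 0) (i 2) * delta (i 1) (i 3) + delta (i 0) (i 3) * delta (i 1) (i 2)) := by
    have e : (fun i : Fin 4 → Fin N => (delta (i 0) (i 1) * delta (i 2) (i 3) +
        delta (i 0) (i 2) * delta (i 1) (i 3) + delta (i 0) (i 3) * delta (i 1) (i 2))) =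
        (fun i => delta (i 0) (i 1) * delta (i 2) (i 3)) +
        (fun i => delta (i 0) (i 2) * delta (i 1) (i 3)) +
        (fun i => delta (i 0) (i 3) * delta (i 1) (i 2)) := rfl
    have e2 := symmetrize_comp (fun i : Fin 4 → Fin N => delta (i 0) (i 1) * delta (i 2) (i 3))
      (Equiv.swap 1 2)
    have e3 := symmetrize_comp (fun i : Fin 4 → Fin N => delta (i 0) (i 2) * delta (i 1) (i 3))
      (Equiv.swap 2 3)
    simp only [Function.comp_apply, Equiv.swap_apply_def] at e2 e3
    norm_num at e2 e3
    simp only [show (0 : Fin 4) ≠ 2 by decide, show (0 : Fin 4) ≠ 3 by decide,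
      show (1 : Fin 4) ≠ 3 by decide, show (3 : Fin 4) ≠ 1 by decide,
      show (3 : Fin 4) ≠ 2 by decide, if_false, show (2 : Fin 4) ≠ 1 by decide,
      show (1 : Fin 4) ≠ 2 by decide] at e2 e3
    rw [← symmetrize_of_mem (delta_pairings_mem N), e, map_add, map_add, e3, e2]
    have e4 : (fun i : Fin 4 → Fin N =>
        3 / ((N : ℝ) + 8) * (delta (i 0) (i 1) * delta (i 2) (i 3))) =
        (3 / ((N : ℝ) + 8)) • fun i => delta (i 0) (i 1) * delta (i 2) (i 3) := rfl
    rw [e4, map_smul]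
    module
  exact congrFun h ![i, j, k, l]

/-! ### Relations between the invariants -/

theorem delta_self (i : Fin N) : delta i i = 1 := if_pos rfl

theorem sum_delta_mul (f : Fin N → ℝ) (i : Fin N) : ∑ m, delta i m * f m = f i := by
  simp [delta]

/-- A fully symmetric function of four indices contracts with `δ_{ij} F_{kl}`, in any of its six
positions, to the same number. -/
theorem sum_mul_delta_pairings {K : Fin N → Fin N → Fin N → Fin N → ℝ}
    (h12 : ∀ i j k l, K i j k l = K j i k l) (h23 : ∀ i j k l, K i j k l = K i k j l)
    (h34 : ∀ i j k l, K i j k l = K i j l k) (F : Fin N → Fin N → ℝ) :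
    ∑ i, ∑ j, ∑ k, ∑ l, K i j k l * (delta i j * F k l + delta i k * F j l + delta i l * F j k +
      delta j k * F i l + delta j l * F i k + delta k l * F i j) =
      6 * ∑ i, ∑ j, F i j * ∑ k, K i j k k := by
  have t6 : ∑ i, ∑ j, ∑ k, ∑ l, K i j k l * (delta k l * F i j) =
      ∑ i, ∑ j, F i j * ∑ k, K i j k k := by
    refine Finset.sum_congr rfl fun i _ => Finset.sum_congr rfl fun j _ => ?_
    rw [Finset.mul_sum]
    refine Finset.sum_congr rfl fun k _ => ?_
    have := sum_delta_mul (fun l => K i j k l * F i j) k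
    simp only [mul_left_comm (K _ _ _ _)]
    rw [this, mul_comm]
  have t5 : ∑ i, ∑ j, ∑ k, ∑ l, K i j k l * (delta j l * F i k) =
      ∑ i, ∑ j, F i j * ∑ k, K i j k k := by
    rw [← t6]
    refine Finset.sum_congr rfl fun i _ => ?_
    rw [Finset.sum_comm]
    simp only [h23 i]
  have t3 : ∑ i, ∑ j, ∑ k, ∑ l, K i j k l * (delta i l * F j k) =
      ∑ i, ∑ j, F i j * ∑ k, K i j k k := by
    rw [← t5, Finset.sum_comm]
    simp only [h12]
  have t4 : ∑ i, ∑ j, ∑ k, ∑ l, K i j k l * (delta j k * F i l) =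
      ∑ i, ∑ j, F i j * ∑ k, K i j k k := by
    rw [← t5]
    refine Finset.sum_congr rfl fun i _ => Finset.sum_congr rfl fun j _ => ?_
    rw [Finset.sum_comm]
    simp only [h34 i j]
  have t2 : ∑ i, ∑ j, ∑ k, ∑ l, K i j k l * (delta i k * F j l) =
      ∑ i, ∑ j, F i j * ∑ k, K i j k k := by
    rw [← t4, Finset.sum_comm]
    simp only [h12]
  have t1 : ∑ i, ∑ j, ∑ k, ∑ l, K i j k l * (delta i j * F k l) =
      ∑ i, ∑ j, F i j * ∑ k, K i j k k := by
    rw [← t2]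
    refine Finset.sum_congr rfl fun i _ => ?_
    rw [Finset.sum_comm]
    simp only [h23 i]
  simp only [mul_add, Finset.sum_add_distrib, t1, t2, t3, t4, t5, t6]
  ring

/-- The traceful part of a tensor with given partial trace is shorter than the tensor. -/
theorem normSq_ge (lam : SymTensor N 4) :
    6 / ((N : ℝ) + 4) * traceNormSq lam - 3 / (((N : ℝ) + 2) * ((N : ℝ) + 4)) * fullTrace lam ^ 2 ≤
      normSq lam := by
  set T := partialTrace lam with hT
  have hTc : ∀ i j, T i j = T j i := partialTrace_comm lam
  -- The constants are forced by giving E, defined below, the partial trace of λ: that trace is (N +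
  -- 4) F + δ tr F, which must equal T. The factor α/2 appears because each product of two deltas
  -- occurs twice in E.
  obtain ⟨α, hα⟩ : ∃ α : ℝ, α = -fullTrace lam / (((N : ℝ) + 2) * ((N : ℝ) + 4)) := ⟨_, rfl⟩
  obtain ⟨β, hβ⟩ : ∃ β : ℝ, β = 1 / ((N : ℝ) + 4) := ⟨_, rfl⟩
  let F : Fin N → Fin N → ℝ := fun i j => α / 2 * delta i j + β * T i j
  have hFc : ∀ i j, F i j = F j i := by
    intro i j
    simp only [F]
    rw [delta_comm, hTc]
  let E : Fin N → Fin N → Fin N → Fin N → ℝ := fun i j k l =>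
    delta i j * F k l + delta i k * F j l + delta i l * F j k +
      delta j k * F i l + delta j l * F i k + delta k l * F i j
  have hE12 : ∀ i j k l, E i j k l = E j i k l := by
    intro i j k l
    simp only [E]
    rw [delta_comm i j, hFc i j]
    ring
  have hE23 : ∀ i j k l, E i j k l = E i k j l := by
    intro i j k l
    simp only [E]
    rw [delta_comm j k, hFc j k]
    ring
  have hE34 : ∀ i j k l, E i j k l = E i j l k := by
    intro i j k l
    simp only [E]
    rw [delta_comm k l, hFc k l]
    ring
  have hN : (N : ℝ) + 4 ≠ 0 := by positivity
  have hN2 : (N : ℝ) + 2 ≠ 0 := by positivity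
  have htrF : ∑ k, F k k = α / 2 * N + β * fullTrace lam := by
    simp only [F, Finset.sum_add_distrib, ← Finset.mul_sum, delta_self, Finset.sum_const,
      Finset.card_univ, Fintype.card_fin, nsmul_eq_mul, mul_one]
    rw [mul_comm (N : ℝ)]
    rfl
  have htr : ∀ i j, ∑ k, E i j k k = T i j := by
    intro i j
    have e : ∀ k, E i j k k = delta i j * F k k + 2 * (delta i k * F j k) + 2 * (delta j k * F i k) +
        F i j := by
      intro k
      simp only [E, delta_self]
      ring
    simp only [e, Finset.sum_add_distrib, ← Finset.mul_sum, sum_delta_mul, htrF,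
      Finset.sum_const, Finset.card_univ, Fintype.card_fin, nsmul_eq_mul]
    rw [hFc j i]
    simp only [F, hα, hβ]
    field_simp
    ring
  have hLE := sum_mul_delta_pairings (comp4_swap12 lam) (comp4_swap23 lam) (comp4_swap34 lam) F
  have hEE := sum_mul_delta_pairings hE12 hE23 hE34 F
  simp only [htr] at hEE
  -- A contraction with E sees only the partial trace, so ⟨λ, E⟩ = ⟨E, E⟩ and 0 ≤ |λ − E|² = S − ⟨E,
  -- E⟩.
  change ∑ i, ∑ j, ∑ k, ∑ l, E i j k l * E i j k l = _ at hEE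
  change ∑ i, ∑ j, ∑ k, ∑ l, comp4 lam i j k l * E i j k l =
    6 * ∑ i, ∑ j, F i j * T i j at hLE
  have hFT : 6 * ∑ i, ∑ j, F i j * T i j = 3 * α * fullTrace lam + 6 * β * traceNormSq lam := by
    simp only [F, add_mul, Finset.sum_add_distrib, mul_assoc, ← Finset.mul_sum, sum_delta_mul]
    simp only [fullTrace, traceNormSq, ← hT, sq]
    ring
  have hpos : 0 ≤ ∑ i, ∑ j, ∑ k, ∑ l, (comp4 lam i j k l - E i j k l) ^ 2 :=
    Finset.sum_nonneg fun _ _ => Finset.sum_nonneg fun _ _ => Finset.sum_nonneg fun _ _ =>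
      Finset.sum_nonneg fun _ _ => sq_nonneg _
  have hexp : ∑ i, ∑ j, ∑ k, ∑ l, (comp4 lam i j k l - E i j k l) ^ 2 =
      normSq lam - 2 * (∑ i, ∑ j, ∑ k, ∑ l, comp4 lam i j k l * E i j k l) +
        ∑ i, ∑ j, ∑ k, ∑ l, E i j k l * E i j k l := by
    have e : ∀ i j k l, (comp4 lam i j k l - E i j k l) ^ 2 = comp4 lam i j k l ^ 2 -
        2 * (comp4 lam i j k l * E i j k l) + E i j k l * E i j k l := fun i j k l => by ring
    simp only [e, Finset.sum_add_distrib, Finset.sum_sub_distrib, ← Finset.mul_sum]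
    rfl
  rw [hexp, hLE, hEE, hFT] at hpos
  have hfin : 3 * α * fullTrace lam + 6 * β * traceNormSq lam = 6 / ((N : ℝ) + 4) * traceNormSq lam -
      3 / (((N : ℝ) + 2) * ((N : ℝ) + 4)) * fullTrace lam ^ 2 := by
    rw [hα, hβ]
    field_simp
    ring
  linarith

theorem fullTrace_sq_le (lam : SymTensor N 4) :
    fullTrace lam ^ 2 ≤ N * traceNormSq lam := by
  have h1 : fullTrace lam ^ 2 ≤ N * ∑ i, partialTrace lam i i ^ 2 := by
    have := sq_sum_le_card_mul_sum_sq (s := (Finset.univ : Finset (Fin N)))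
      (f := fun i => partialTrace lam i i)
    simpa [fullTrace] using this
  refine h1.trans (mul_le_mul_of_nonneg_left ?_ (by positivity))
  refine Finset.sum_le_sum fun i _ => ?_
  exact Finset.single_le_sum (f := fun j => partialTrace lam i j ^ 2) (fun j _ => sq_nonneg _)
    (Finset.mem_univ i)

/-- Contract i with j and k with l: of the three quadratic terms one gives q, the other two give S
each. -/
theorem IsFixedPoint.fullTrace_eq {lam : SymTensor N 4} (h : IsFixedPoint lam) :
    fullTrace lam = traceNormSq lam + 2 * normSq lam := by
  have h0 : ∑ i, ∑ k, beta lam i i k k = 0 := by simp [h _ _ _ _]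
  have e : ∀ i k, beta lam i i k k = -comp4 lam i i k k +
      (∑ m, ∑ n, comp4 lam i i m n * comp4 lam k k m n +
        2 * ∑ m, ∑ n, comp4 lam i k m n ^ 2) := by
    intro i k
    rw [Finset.mul_sum, ← Finset.sum_add_distrib]
    refine congrArg _ (Finset.sum_congr rfl fun m _ => ?_)
    rw [Finset.mul_sum, ← Finset.sum_add_distrib]
    refine Finset.sum_congr rfl fun n _ => ?_
    simp only [comp4]
    ring
  have t : ∑ i, ∑ k, ∑ m, ∑ n, comp4 lam i i m n * comp4 lam k k m n = traceNormSq lam := by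
    rw [sum_swap_pairs]
    refine Finset.sum_congr rfl fun m _ => Finset.sum_congr rfl fun n _ => ?_
    simp only [comp4_swap_pairs lam _ _ m n, ← Finset.mul_sum, ← Finset.sum_mul]
    exact (sq _).symm
  simp only [e, Finset.sum_add_distrib, Finset.sum_neg_distrib, ← Finset.mul_sum] at h0
  rw [t] at h0
  change -fullTrace lam + (traceNormSq lam + 2 * normSq lam) = 0 at h0
  linarith

/-! ### Invariants of the O(N) fixed point -/

theorem partialTrace_couplingON (i j : Fin N) :
    partialTrace (couplingON N) i j = ((N : ℝ) + 2) / ((N : ℝ) + 8) * delta i j := by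
  unfold partialTrace
  have h : ∀ k, comp4 (couplingON N) i j k k =
      1 / ((N : ℝ) + 8) * (delta i j + 2 * (delta i k * delta j k)) := by
    intro k
    rw [comp4_couplingON, delta_self]
    ring
  simp only [h, ← Finset.mul_sum, Finset.sum_add_distrib, sum_delta_mul, Finset.sum_const,
    Finset.card_univ, Fintype.card_fin, nsmul_eq_mul]
  rw [delta_comm j i]
  ring

theorem fullTrace_couplingON (N : ℕ) :
    fullTrace (couplingON N) = N * ((N : ℝ) + 2) / ((N : ℝ) + 8) := by
  unfold fullTrace
  simp only [partialTrace_couplingON, delta_self, Finset.sum_const, Finset.card_univ,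
    Fintype.card_fin, nsmul_eq_mul]
  ring

theorem traceNormSq_couplingON (N : ℕ) :
    traceNormSq (couplingON N) = N * ((N : ℝ) + 2) ^ 2 / ((N : ℝ) + 8) ^ 2 := by
  unfold traceNormSq
  have h : ∀ i j : Fin N, (((N : ℝ) + 2) / ((N : ℝ) + 8) * delta i j) ^ 2 =
      (((N : ℝ) + 2) / ((N : ℝ) + 8)) ^ 2 * (delta i j * delta i j) := fun i j => by ring
  simp only [partialTrace_couplingON, h, ← Finset.mul_sum, sum_delta_mul, delta_self,
    Finset.sum_const, Finset.card_univ, Fintype.card_fin, nsmul_eq_mul]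
  rw [div_pow]
  ring

theorem normSq_couplingON (N : ℕ) :
    normSq (couplingON N) = 3 * N * ((N : ℝ) + 2) / ((N : ℝ) + 8) ^ 2 := by
  have h := sum_mul_delta_pairings (comp4_swap12 (couplingON N)) (comp4_swap23 (couplingON N))
    (comp4_swap34 (couplingON N)) delta
  -- For F = δ the six-term bracket is itself 2(N + 8) times the O(N) tensor, so the contraction
  -- computes the norm from the full trace.
  have e : ∀ i j k l, comp4 (couplingON N) i j k l * (delta i j * delta k l + delta i k * delta j l +
      delta i l * delta j k + delta j k * delta i l + delta j l * delta i k + delta k l * delta i j) =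
      2 * ((N : ℝ) + 8) * comp4 (couplingON N) i j k l ^ 2 := by
    intro i j k l
    have : (N : ℝ) + 8 ≠ 0 := by positivity
    rw [comp4_couplingON]
    field_simp
    ring
  simp only [e, ← Finset.mul_sum, sum_delta_mul] at h
  change 2 * ((N : ℝ) + 8) * normSq (couplingON N) = 6 * fullTrace (couplingON N) at h
  rw [fullTrace_couplingON] at h
  have : (N : ℝ) + 8 ≠ 0 := by positivity
  field_simp at h ⊢
  linarith

/-! ### Inequalities for the second moment -/

/-- The second moment as a function of the three quadratic invariants. -/
theorem secondMoment_le {n a q S c₂ c₃ c₄ : ℝ} (hn : 0 < n) (ha : a = q + 2 * S)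
    (hq : a ^ 2 ≤ n * q)
    (hS : 6 / (n + 4) * q - 3 / ((n + 2) * (n + 4)) * a ^ 2 ≤ S)
    (h₂ : 0 ≤ c₂) (h₃ : 0 ≤ c₃) (h₄ : 0 ≤ c₄)
    (hc : (n - 4) * (c₄ + 2 * c₃ + c₂) ≤ 4 * (n + 2) * ((n + 4) * c₄ + 4 * c₃)) :
    c₄ * (a ^ 2 + 4 * q + S) + c₃ * (4 * q + 2 * S) + c₂ * S ≤
      c₄ * ((n * (n + 2) / (n + 8)) ^ 2 + 4 * (n * (n + 2) ^ 2 / (n + 8) ^ 2) +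
        3 * n * (n + 2) / (n + 8) ^ 2) +
      c₃ * (4 * (n * (n + 2) ^ 2 / (n + 8) ^ 2) + 2 * (3 * n * (n + 2) / (n + 8) ^ 2)) +
      c₂ * (3 * n * (n + 2) / (n + 8) ^ 2) := by
  obtain ⟨K, hK⟩ : ∃ K, K = c₄ + 2 * c₃ + c₂ := ⟨_, rfl⟩
  obtain ⟨b, hb⟩ : ∃ b, b = n * (n + 2) / (n + 8) := ⟨_, rfl⟩
  obtain ⟨A, hA⟩ : ∃ A, A = c₄ + 4 * (c₄ + c₃) / n + 3 * K / (n * (n + 2)) := ⟨_, rfl⟩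
  obtain ⟨t, ht⟩ : ∃ t, t = q - a ^ 2 / n := ⟨_, rfl⟩
  obtain ⟨d, hd⟩ : ∃ d, d = S - (6 / (n + 4) * q - 3 / ((n + 2) * (n + 4)) * a ^ 2) := ⟨_, rfl⟩
  have hK0 : 0 ≤ K := by rw [hK]; positivity
  have ht0 : 0 ≤ t := by
    rw [ht, sub_nonneg, div_le_iff₀ hn]
    linarith
  have hd0 : 0 ≤ d := by linarith
  have hA0 : 0 ≤ A := by rw [hA]; positivity
  have e1 : c₄ * (a ^ 2 + 4 * q + S) + c₃ * (4 * q + 2 * S) + c₂ * S =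
      A * a ^ 2 + (4 * (c₄ + c₃) + 6 * K / (n + 4)) * t + K * d := by
    rw [hA, ht, hd, hK]
    field_simp
    ring
  have e2 : c₄ * ((n * (n + 2) / (n + 8)) ^ 2 + 4 * (n * (n + 2) ^ 2 / (n + 8) ^ 2) +
        3 * n * (n + 2) / (n + 8) ^ 2) +
      c₃ * (4 * (n * (n + 2) ^ 2 / (n + 8) ^ 2) + 2 * (3 * n * (n + 2) / (n + 8) ^ 2)) +
      c₂ * (3 * n * (n + 2) / (n + 8) ^ 2) = A * b ^ 2 := by
    rw [hA, hb, hK]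
    field_simp
    ring
  -- The relation a = q + 2S in terms of the slacks.
  have e3 : b * ((n + 16) / (n + 4) * t + 2 * d) = b * a - a ^ 2 := by
    have hS' : S = (a - q) / 2 := by linarith
    rw [ht, hd, hb, hS']
    field_simp
    ring
  have hAb : A * b = ((n + 2) * (n * c₄ + 4 * (c₄ + c₃)) + 3 * K) / (n + 8) := by
    rw [hA, hb]
    field_simp
  -- Once denominators are cleared this is exactly `hc`; the bound `k2` on the coefficient of t
  -- needs no such condition.
  have k1 : K ≤ 4 * (A * b) := by
    rw [hAb, mul_div_assoc', le_div_iff₀ (by positivity)]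
    rw [← hK] at hc
    linarith
  have k2 : 4 * (c₄ + c₃) + 6 * K / (n + 4) ≤ 2 * (A * b) * ((n + 16) / (n + 4)) := by
    rw [hAb]
    have : 2 * (((n + 2) * (n * c₄ + 4 * (c₄ + c₃)) + 3 * K) / (n + 8)) * ((n + 16) / (n + 4)) -
        (4 * (c₄ + c₃) + 6 * K / (n + 4)) = ((2 * (n + 2) * n * (n + 16)) * c₄ +
          (4 * n ^ 2 + 96 * n + 128) * (c₄ + c₃) + 48 * K) / ((n + 8) * (n + 4)) := by
      field_simp
      ring
    have h : 0 ≤ ((2 * (n + 2) * n * (n + 16)) * c₄ +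
          (4 * n ^ 2 + 96 * n + 128) * (c₄ + c₃) + 48 * K) / ((n + 8) * (n + 4)) := by
      positivity
    linarith
  rw [e1, e2]
  -- The slack terms cost at most 2A(ab − a²), and A a² + 2A(ab − a²) = A b² − A(b − a)².
  have m1 := mul_le_mul_of_nonneg_right k1 hd0
  have m2 := mul_le_mul_of_nonneg_right k2 ht0
  have m3 : 2 * A * (b * ((n + 16) / (n + 4) * t + 2 * d)) = 2 * A * (b * a - a ^ 2) := by rw [e3]
  have m4 := mul_nonneg hA0 (sq_nonneg (b - a))
  linarith

/-- Hypothesis `hc` of `secondMoment_le` for the actual weights, denominators cleared and u = r − 2,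
so that u + 7/8 = r − 9/8. -/
theorem dominance_condition {n u : ℝ} (hn : 2 ≤ n) (hu : 1 ≤ u)
    (h : n ≤ 4 * (u + 7 / 8) ^ 2) :
    (n - 4) * ((n + 2) * (n + 3) + 2 * u * (n + 3) + u * (u - 1)) ≤
      4 * (n + 2) * ((n + 4) * (u * (u - 1)) + 4 * u * (n + 3)) := by
  have hB : 1 ≤ 4 * u ^ 2 + 10 * u + 4 - n := by linarith
  -- With P = n + 2 and B = 4u² + 10u + 4 − n, the claim `key` reads PB + 13u − u² ≥ 0. Since P, B ≥
  -- 1, PB ≥ P + B − 1, where n cancels and 4u² + 10u + 5 is left.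
  have hP := mul_nonneg (show 0 ≤ n + 2 - 1 by linarith) (sub_nonneg.mpr hB)
  have hv : 0 ≤ u * (u - 1) := mul_nonneg (by linarith) (by linarith)
  have key : (n - 4) * (n + 2 + 2 * u) + u * (u - 1) ≤ 4 * (n + 2) * (u * (u - 1) + 4 * u) := by
    nlinarith
  have key2 := mul_le_mul_of_nonneg_left key (show 0 ≤ n + 3 by linarith)
  have h5 := mul_nonneg (show 0 ≤ n + 2 by linarith) hv
  linarith

theorem secondMoment_couplingON_bound {n u : ℝ} (hn : 2 ≤ n) (hu : 1 ≤ u) :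
    (n + 5) ^ 2 * ((n + 3) ^ 2 * (u * (u - 1)) + 2 * (u * (u - 1)) +
      ((4 * n + 14) * u + 3 * n + 6) * (n + 3)) <
    (n + 1) * (n + 8) ^ 2 * (n + 3) * (u ^ 2 + 3 * u + 3) := by
  -- Shifting both variables to their lower bounds leaves a polynomial difference with no negative
  -- coefficients.
  obtain ⟨x, rfl⟩ : ∃ x, n = 2 + x := ⟨n - 2, by ring⟩
  obtain ⟨y, rfl⟩ : ∃ y, u = 1 + y := ⟨u - 1, by ring⟩
  have hx : 0 ≤ x := by linarith
  have hy : 0 ≤ y := by linarith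
  rw [← sub_pos]
  ring_nf
  positivity

theorem bodyRatio_two (N s : ℕ) :
    bodyRatio N (s + 2) 2 = ((s : ℝ) + 2) * ((s : ℝ) + 1) / ((N : ℝ) * ((N : ℝ) + 1)) := by
  simp only [bodyRatio, Finset.prod_range_succ, Finset.prod_range_zero]
  push_cast
  rw [one_mul, div_mul_div_comm]
  congr 1 <;> ring

theorem bodyRatio_three (N s : ℕ) :
    bodyRatio N (s + 2) 3 = bodyRatio N (s + 2) 2 * ((s : ℝ) / ((N : ℝ) + 2)) := by
  rw [bodyRatio, Finset.prod_range_succ, ← bodyRatio]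
  push_cast
  congr 2
  ring

theorem bodyRatio_four (N s : ℕ) :
    bodyRatio N (s + 2) 4 = bodyRatio N (s + 2) 2 *
      ((s : ℝ) * ((s : ℝ) - 1) / (((N : ℝ) + 2) * ((N : ℝ) + 3))) := by
  rw [bodyRatio, Finset.prod_range_succ, ← bodyRatio, bodyRatio_three, mul_assoc,
    div_mul_div_comm]
  push_cast
  congr 3
  ring

/-! ### Bounds at a fixed point -/

/-- Eliminating S and then q from a = q + 2S by the two inequalities leaves (N + 8) a² ≤ N(N + 2) a,
which forces a ≥ 0 and then bounds it. -/
theorem IsFixedPoint.fullTrace_le {lam : SymTensor N 4} (h : IsFixedPoint lam) (hN : 0 < N) :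
    0 ≤ fullTrace lam ∧ fullTrace lam ≤ N * ((N : ℝ) + 2) / ((N : ℝ) + 8) := by
  have ha := h.fullTrace_eq
  have hq := fullTrace_sq_le lam
  have hS := normSq_ge lam
  have hn : (0 : ℝ) < N := by exact_mod_cast hN
  generalize (N : ℝ) = n at *
  generalize fullTrace lam = a at *
  generalize traceNormSq lam = q at *
  generalize normSq lam = S at *
  have h1 : a ^ 2 * (n + 8) ≤ a * (n * (n + 2)) := by
    have e : 6 / (n + 4) * q - 3 / ((n + 2) * (n + 4)) * a ^ 2 =
        (6 * (n + 2) * q - 3 * a ^ 2) / ((n + 2) * (n + 4)) := by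
      field_simp
    rw [e, div_le_iff₀ (by positivity)] at hS
    have h2 : (n + 16) * (n + 2) * q - 6 * a ^ 2 ≤ a * ((n + 2) * (n + 4)) := by
      rw [ha] at hS ⊢
      linarith
    have h3 := mul_le_mul_of_nonneg_left hq (show 0 ≤ (n + 16) * (n + 2) by positivity)
    have h4 := mul_le_mul_of_nonneg_left h2 hn.le
    have h5 : (n + 4) * (a ^ 2 * (n + 8)) ≤ (n + 4) * (a * (n * (n + 2))) := by linarith
    exact le_of_mul_le_mul_left h5 (by positivity)
  have h0 : 0 ≤ a := by
    by_contra hneg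
    push Not at hneg
    have h2 : a * (n * (n + 2)) < 0 := mul_neg_of_neg_of_pos hneg (by positivity)
    have h3 : 0 ≤ a ^ 2 * (n + 8) := by positivity
    linarith
  refine ⟨h0, ?_⟩
  rw [le_div_iff₀ (by positivity)]
  rcases h0.eq_or_lt with rfl | hpos
  · rw [zero_mul]
    positivity
  · refine le_of_mul_le_mul_left ?_ hpos
    linarith

theorem IsFixedPoint.normSq_le {lam : SymTensor N 4} (h : IsFixedPoint lam) (hN : 0 < N) :
    normSq lam ≤ (fullTrace lam - fullTrace lam ^ 2 / N) / 2 := by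
  have ha := h.fullTrace_eq
  have hn : (0 : ℝ) < N := by exact_mod_cast hN
  have hq : fullTrace lam ^ 2 / N ≤ traceNormSq lam := by
    rw [div_le_iff₀ hn]
    linarith [fullTrace_sq_le lam]
  linarith

/-- The bound (a − a²/N)/2 increases up to a = N/2 and is attained at O(N), where a = b; b ≤ N/2
holds precisely when N ≤ 4. -/
theorem IsFixedPoint.normSq_le_couplingON {lam : SymTensor N 4} (h : IsFixedPoint lam)
    (hN : 0 < N) (hN4 : N ≤ 4) : normSq lam ≤ normSq (couplingON N) := by
  refine (h.normSq_le hN).trans ?_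
  rw [normSq_couplingON]
  obtain ⟨-, hb⟩ := h.fullTrace_le hN
  have hn : (0 : ℝ) < N := by exact_mod_cast hN
  have hn4 : (N : ℝ) ≤ 4 := by exact_mod_cast hN4
  generalize (N : ℝ) = n at *
  generalize fullTrace lam = a at *
  obtain ⟨b, hb'⟩ : ∃ b, b = n * (n + 2) / (n + 8) := ⟨_, rfl⟩
  have hb2 : b ≤ n / 2 := by
    rw [hb', div_le_div_iff₀ (by positivity) (by positivity)]
    nlinarith
  have e : 3 * n * (n + 2) / (n + 8) ^ 2 = (b - b ^ 2 / n) / 2 := by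
    rw [hb']
    field_simp
    ring
  rw [← hb'] at hb
  have e2 : (b - b ^ 2 / n) / 2 - (a - a ^ 2 / n) / 2 = (b - a) * (n - b - a) / (2 * n) := by
    field_simp
    ring
  have h3 : 0 ≤ (b - a) * (n - b - a) / (2 * n) :=
    div_nonneg (mul_nonneg (by linarith) (by linarith)) (by positivity)
  rw [e]
  linarith

theorem IsFixedPoint.normSq_le_eighth {lam : SymTensor N 4} (h : IsFixedPoint lam)
    (hN : 0 < N) : normSq lam ≤ N / 8 := by
  refine (h.normSq_le hN).trans ?_
  have hn : (0 : ℝ) < N := by exact_mod_cast hN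
  have e : (N : ℝ) / 8 - (fullTrace lam - fullTrace lam ^ 2 / N) / 2 =
      (fullTrace lam - N / 2) ^ 2 / (2 * N) := by
    field_simp
    ring
  have : 0 ≤ (fullTrace lam - N / 2) ^ 2 / (2 * N) := by positivity
  linarith

theorem IsFixedPoint.avgGamma_two_le {M s : ℕ} {lam : SymTensor (M + 1) 4} (h : IsFixedPoint lam)
    (hM : 1 ≤ M) (hs : 1 ≤ s) (hr : ((M + 1 : ℕ) : ℝ) ≤ 4 * ((s : ℝ) + 7 / 8) ^ 2) :
    avgGamma lam 2 (s + 2) ≤ avgGamma (couplingON (M + 1)) 2 (s + 2) := by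
  rw [avgGamma_two, avgGamma_two, fullTrace_couplingON, traceNormSq_couplingON,
    normSq_couplingON]
  have hn : (2 : ℝ) ≤ (M + 1 : ℕ) := by exact_mod_cast Nat.succ_le_succ hM
  have hu : (1 : ℝ) ≤ s := by exact_mod_cast hs
  have hv : (0 : ℝ) ≤ s * ((s : ℝ) - 1) := mul_nonneg (by linarith) (by linarith)
  have h₂ : 0 ≤ bodyRatio (M + 1) (s + 2) 2 := by
    rw [bodyRatio_two]
    positivity
  refine secondMoment_le (by linarith) h.fullTrace_eq (fullTrace_sq_le lam) (normSq_ge lam) h₂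
    ?_ ?_ ?_
  · rw [bodyRatio_three]
    positivity
  · rw [bodyRatio_four]
    exact mul_nonneg h₂ (div_nonneg hv (by positivity))
  · rw [bodyRatio_three, bodyRatio_four]
    have hd := dominance_condition hn hu hr
    generalize ((M + 1 : ℕ) : ℝ) = n at *
    generalize bodyRatio (M + 1) (s + 2) 2 = c at *
    generalize (s : ℝ) = u at *
    have hp : 0 < (n + 2) * (n + 3) := by positivity
    have hd' := mul_le_mul_of_nonneg_left hd (div_nonneg h₂ hp.le)
    have e1 : (n - 4) * (c * (u * (u - 1) / ((n + 2) * (n + 3))) + 2 * (c * (u / (n + 2))) + c) =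
        c / ((n + 2) * (n + 3)) *
          ((n - 4) * ((n + 2) * (n + 3) + 2 * u * (n + 3) + u * (u - 1))) := by
      field_simp
      ring
    have e2 : 4 * (n + 2) * ((n + 4) * (c * (u * (u - 1) / ((n + 2) * (n + 3)))) +
        4 * (c * (u / (n + 2)))) = c / ((n + 2) * (n + 3)) *
          (4 * (n + 2) * ((n + 4) * (u * (u - 1)) + 4 * u * (n + 3))) := by
      field_simp
    rw [e1, e2]
    exact hd'

theorem avgGamma_two_couplingON_lt {M s : ℕ} (hM : 1 ≤ M) (hs : 1 ≤ s) :
    avgGamma (couplingON (M + 1)) 2 (s + 2) < ((s : ℝ) + 2) * ((s : ℝ) + 1) *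
      ((s : ℝ) ^ 2 + 3 * s + 3) / (((M + 1 : ℕ) : ℝ) + 5) ^ 2 := by
  rw [avgGamma_two, fullTrace_couplingON, traceNormSq_couplingON, normSq_couplingON,
    bodyRatio_four, bodyRatio_three, bodyRatio_two]
  have hn : (2 : ℝ) ≤ (M + 1 : ℕ) := by exact_mod_cast Nat.succ_le_succ hM
  have hu : (1 : ℝ) ≤ s := by exact_mod_cast hs
  have hb := secondMoment_couplingON_bound hn hu
  generalize ((M + 1 : ℕ) : ℝ) = n at *
  generalize (s : ℝ) = u at *
  have e : (u + 2) * (u + 1) / (n * (n + 1)) * (u * (u - 1) / ((n + 2) * (n + 3))) *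
        ((n * (n + 2) / (n + 8)) ^ 2 + 4 * (n * (n + 2) ^ 2 / (n + 8) ^ 2) +
          3 * n * (n + 2) / (n + 8) ^ 2) +
      (u + 2) * (u + 1) / (n * (n + 1)) * (u / (n + 2)) *
        (4 * (n * (n + 2) ^ 2 / (n + 8) ^ 2) + 2 * (3 * n * (n + 2) / (n + 8) ^ 2)) +
      (u + 2) * (u + 1) / (n * (n + 1)) * (3 * n * (n + 2) / (n + 8) ^ 2) =
      (u + 2) * (u + 1) * ((n + 3) ^ 2 * (u * (u - 1)) + 2 * (u * (u - 1)) +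
        ((4 * n + 14) * u + 3 * n + 6) * (n + 3)) / ((n + 1) * (n + 8) ^ 2 * (n + 3)) := by
    field_simp
    ring
  rw [e, div_lt_div_iff₀ (by positivity) (by positivity)]
  have := mul_lt_mul_of_pos_left hb (show 0 < (u + 2) * (u + 1) by positivity)
  linarith

end OneLoop

/-! ### The main theorem -/

theorem theorem1 {N : ℕ} (hN : 2 ≤ N) (lam : OneLoop.SymTensor N 4)
    (hlam : OneLoop.IsFixedPoint lam) :
    (∀ r : ℕ, 2 ≤ r →
      (OneLoop.anomalousDims lam r).card = OneLoop.numOps N r ∧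
      (OneLoop.anomalousDims (OneLoop.couplingON N) r).card = OneLoop.numOps N r) ∧
    (∀ r : ℕ, 2 ≤ r →
      OneLoop.avgGamma lam 1 r ≤ OneLoop.avgGamma (OneLoop.couplingON N) 1 r) ∧
    (N ≤ 4 → OneLoop.avgGamma lam 2 2 ≤ OneLoop.avgGamma (OneLoop.couplingON N) 2 2) ∧
    (5 ≤ N → OneLoop.avgGamma lam 2 2 ≤ 1 / (4 * ((N : ℝ) + 1))) ∧
    (∀ r : ℕ, 3 ≤ r → (N : ℝ) ≤ 4 * ((r : ℝ) - 9 / 8) ^ 2 →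
      OneLoop.avgGamma lam 2 r ≤ OneLoop.avgGamma (OneLoop.couplingON N) 2 r ∧
      OneLoop.avgGamma (OneLoop.couplingON N) 2 r <
        (r : ℝ) * ((r : ℝ) - 1) * ((r : ℝ) ^ 2 - (r : ℝ) + 1) / ((N : ℝ) + 5) ^ 2) := by
  obtain ⟨M, rfl⟩ : ∃ M, N = M + 1 := ⟨N - 1, by omega⟩
  -- At r = 2 the 3- and 4-body weights vanish, so only S survives.
  have avg2 : ∀ lam' : OneLoop.SymTensor (M + 1) 4, OneLoop.avgGamma lam' 2 2 =
      2 / (((M + 1 : ℕ) : ℝ) * (((M + 1 : ℕ) : ℝ) + 1)) * OneLoop.normSq lam' := by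
    intro lam'
    have h := OneLoop.avgGamma_two lam' 0
    rw [OneLoop.bodyRatio_four, OneLoop.bodyRatio_three, OneLoop.bodyRatio_two] at h
    simp only [Nat.cast_zero, zero_div, zero_mul, mul_zero, zero_add, mul_one] at h
    exact h
  refine ⟨?_, ?_, ?_, ?_, ?_⟩
  · intro r hr
    obtain ⟨s, rfl⟩ : ∃ s, r = s + 2 := ⟨r - 2, by omega⟩
    exact ⟨OneLoop.card_anomalousDims _ _, OneLoop.card_anomalousDims _ _⟩
  · intro r hr
    obtain ⟨s, rfl⟩ : ∃ s, r = s + 2 := ⟨r - 2, by omega⟩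
    rw [OneLoop.avgGamma_one, OneLoop.avgGamma_one, OneLoop.fullTrace_couplingON,
      OneLoop.bodyRatio_two]
    exact mul_le_mul_of_nonneg_left (hlam.fullTrace_le (by omega)).2 (by positivity)
  · intro h4
    rw [avg2, avg2]
    exact mul_le_mul_of_nonneg_left (hlam.normSq_le_couplingON (by omega) h4) (by positivity)
  · intro _
    rw [avg2]
    refine (mul_le_mul_of_nonneg_left (hlam.normSq_le_eighth (by omega)) (by positivity)).trans
      (le_of_eq ?_)
    have : ((M + 1 : ℕ) : ℝ) ≠ 0 := by positivity
    field_simp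
    norm_num
  · intro r hr hN2
    obtain ⟨s, rfl⟩ : ∃ s, r = s + 2 := ⟨r - 2, by omega⟩
    have e1 : ((s + 2 : ℕ) : ℝ) - 9 / 8 = (s : ℝ) + 7 / 8 := by
      push_cast
      ring
    rw [e1] at hN2
    refine ⟨hlam.avgGamma_two_le (by omega) (by omega) hN2, ?_⟩
    refine (OneLoop.avgGamma_two_couplingON_lt (by omega) (by omega)).trans_eq ?_
    congr 1
    push_cast
    ring
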